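/- Let $L^*$ be a positive semidefinite and $S^*$ a symmetric real $J\times J$ matrix, $M^*=L^*+S^*$, $K=\mathrm{rank}(L^*)$, and let $L^*=U_1^*D_1^*U_1^{*\top}$, where $U_1^*$ is $J\times K$ with $U_1^{*\top}U_1^*=I_K$ and $D_1^*$ is diagonal with positive entries. Let $X_1,X_2,\dots$ be i.i.d. random vectors in $\{0,1\}^J$ with $\mathbb P(X_i=x)\propto\exp\{\tfrac12x^\top M^*x\}$. For a matrix $M$ let $\mathcal L_j(M;x)=\mathbb P_M(X_j=x_j\mid X_{-j}=x_{-j})$ be the conditional likelihood under the model $\mathbb P_M(X=x)\propto\exp\{\tfrac12x^\top Mx\}$; for symmetric $M$ this is the logistic model in which $X_j=1$ has log-odds $\tfrac12m_{jj}+\sum_{i\ne j}m_{ij}x_i$. Put $h_N(M)=-\frac1N\sum_{i=1}^N\sum_{j=1}^J\log\mathcal L_j(M;X_i)$. For $\gamma_N,\delta_N>0$ consider $$\min\Big\{h_N(L+S)+\gamma_N\sum_{i\ne j}|s_{ij}|+\delta_N\|L\|_*\;:\;L\succeq0,\ S=S^\top\Big\},\qquad(1)$$ where $\|L\|_*$ is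 the nuclear norm. Let $\mathcal I^*=\mathbb E\{\partial^2h_1/\partial^2M|_{M=M^*}\}$, a $J^2\times J^2$ matrix acting on $J\times J$ matrices by vectorization. Let $\mathcal S^*$ be the space of symmetric $S$ with $s_{ij}=0$ whenever $i\neq j$ and $s^*_{ij}=0$, and let $\mathcal T^*=\{U_1^*Y+Y^\top U_1^{*\top}:Y\in\mathbb R^{K\times J}\}$. Let $\mathbf P$ denote orthogonal projection and $\perp$ orthogonal complement for the inner product $\mathrm{Trace}(AB^\top)$ on $\mathbb R^{J\times J}$. On $\mathcal S^*\times\mathcal T^*$ put $$\mathbf F(S,L)=(\mathbf P_{\mathcal S^*}\{\mathcal I^*(S+L)\},\mathbf P_{\mathcal T^*}\{\mathcal I^*(S+L)\}),\quad \mathbf F^\perp(S,L)=(\mathbf P_{\mathcal S^{*\perp}}\{\mathcal I^*(S+L)\},\mathbf P_{\mathcal T^{*\perp}}\{\mathcal I^*(S+L)\}).$$ Let $\mathbf O(S^*)$ be $S^*$ with its diagonal replaced by zeros, let $\mathrm{sign}$ act entrywise, and let $\|(A,B)\|_\rho=\max(\|A\|_\infty,\|B\|_2/\rho)$ with the maximum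 and the spectral norm. Assume: - A1: $v^\top\mathcal I^*v\ge0$, with equality if and only if $v=0$, for every (vectorized) $v\in\{L+S:L\succeq0,\ S=S^\top\}$; - A2: the positive eigenvalues of $L^*$ are distinct; - A3: $\mathcal S^*\cap\mathcal T^*=\{0\}$; - A4: $\rho>0$ satisfies $\big\|\mathbf F^\perp\mathbf F^{-1}(\mathrm{sign}(\mathbf O(S^*)),\rho U_1^*U_1^{*\top})\big\|_\rho<1$ (under A1 and A3 the operator $\mathbf F$ is an invertible map of $\mathcal S^*\times\mathcal T^*$ onto itself). Then, for every sufficiently small constant $\eta>0$, with tuning parameters $\delta_N=\rho\gamma_N=N^{-\frac12+\eta}$: 1. with probability tending to $1$ as $N\to\infty$, problem (1) has a unique solution $(\hat L,\hat S)$; 2. $(\hat L,\hat S)$ converges in probability to $(L^*,S^*)$; 3. with probability tending to $1$, $\mathrm{rank}(\hat L)=\mathrm{rank}(L^*)$, and $\mathrm{sign}(\hat s_{ij})=\mathrm{sign}(s^*_{ij})$ for all $i\neq j$ and also for all $i=j$ with $s^*_{ii}\neq0$. (In particular $\mathrm{sign}(\hat S)=\mathrm{sign}(S^*)$ with probability tending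 to $1$ if the diagonal entries of $S^*$ are nonzero.) -/

import Mathlib

open MeasureTheory ProbabilityTheory Filter Topology

noncomputable section

namespace FLaG

/-! ### The fused latent and graphical model, with the latent vector integrated out -/

/-- A configuration `x ∈ {0,1}^J`. -/
abbrev Config (J : ℕ) : Type := Fin J → Bool

/-- The real vector with entries in `{0,1}` that a configuration stands for. -/
def toVec {J : ℕ} (x : Config J) : Fin J → ℝ := fun j => if x j then 1 else 0

/-- The unnormalised probability `exp (xᵀ M x / 2)`. -/
def weight {J : ℕ} (M : Matrix (Fin J) (Fin J) ℝ) (x : Config J) : ℝ :=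
  Real.exp (1 / 2 * (toVec x ⬝ᵥ M.mulVec (toVec x)))

/-- The probability mass function `f(x | L, S) ∝ exp (xᵀ (L + S) x / 2)`, as a function of
`M = L + S`. -/
def pmf {J : ℕ} (M : Matrix (Fin J) (Fin J) ℝ) (x : Config J) : ℝ :=
  weight M x / ∑ y : Config J, weight M y

/-! ### Pseudo-likelihood -/

/-- The conditional likelihood `ℙ(X_j = x_j | X_{-j} = x_{-j})` under the model with `M = L + S`. -/
def condLik {J : ℕ} (M : Matrix (Fin J) (Fin J) ℝ) (j : Fin J) (x : Config J) : ℝ :=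
  pmf M x / ∑ b : Bool, pmf M (Function.update x j b)

/-- The pseudo-likelihood of `N` observations. -/
def pseudoLik {J N : ℕ} (M : Matrix (Fin J) (Fin J) ℝ) (x : Fin N → Config J) : ℝ :=
  ∏ i, ∏ j, condLik M j (x i)

/-- `h_N(M) = -(1/N) log (pseudo-likelihood)`. -/
def negLogPL {J N : ℕ} (x : Fin N → Config J) (M : Matrix (Fin J) (Fin J) ℝ) : ℝ :=
  -(1 / (N : ℝ)) * Real.log (pseudoLik M x)

/-! ### The regularised estimator -/

/-- `‖O(S)‖₁`, the sum of the absolute values of the off-diagonal entries. -/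
def offDiagL1 {J : ℕ} (S : Matrix (Fin J) (Fin J) ℝ) : ℝ :=
  ∑ i, ∑ j, if i = j then 0 else |S i j|

open Classical in
/-- The nuclear norm of a symmetric matrix, the sum of the absolute values of its eigenvalues
(it is only used for positive semidefinite matrices). -/
def nuclearNorm {J : ℕ} (L : Matrix (Fin J) (Fin J) ℝ) : ℝ :=
  if h : L.IsHermitian then ∑ i, |h.eigenvalues i| else 0

/-- The objective function of the regularised pseudo-likelihood problem. -/
def objective {J N : ℕ} (γ δ : ℝ) (x : Fin N → Config J) (L S : Matrix (Fin J) (Fin J) ℝ) : ℝ :=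
  negLogPL x (L + S) + γ * offDiagL1 S + δ * nuclearNorm L

/-- The set of solutions `(L̂, Ŝ)` of the regularised pseudo-likelihood problem: minimisers of the
objective over positive semidefinite `L` and symmetric `S`. -/
def solutions {J N : ℕ} (γ δ : ℝ) (x : Fin N → Config J) :
    Set (Matrix (Fin J) (Fin J) ℝ × Matrix (Fin J) (Fin J) ℝ) :=
  {p | p.1.PosSemidef ∧ p.2.IsSymm ∧
    ∀ L S : Matrix (Fin J) (Fin J) ℝ, L.PosSemidef → S.IsSymm →
      objective γ δ x p.1 p.2 ≤ objective γ δ x L S}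

/-! ### Information of the pseudo-likelihood -/

/-- The second partial derivative `∂² f / ∂m_p ∂m_q` at `M`. -/
def partialDeriv₂ {J : ℕ} (f : Matrix (Fin J) (Fin J) ℝ → ℝ) (M : Matrix (Fin J) (Fin J) ℝ)
    (p q : Fin J × Fin J) : ℝ :=
  deriv (fun s : ℝ => deriv (fun t : ℝ =>
    f (M + s • Matrix.single p.1 p.2 1 + t • Matrix.single q.1 q.2 1)) 0) 0

/-- The `J² × J²` information matrix `𝔼 {∂² h₁ / ∂²M}` at the true parameter `M`, the expectation
being taken under the model with parameter `M`. -/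
def info {J : ℕ} (M : Matrix (Fin J) (Fin J) ℝ) : Matrix (Fin J × Fin J) (Fin J × Fin J) ℝ :=
  Matrix.of fun p q =>
    ∑ x : Config J, pmf M x * partialDeriv₂ (negLogPL (fun _ : Fin 1 => x)) M p q

/-- The vectorisation of a matrix. -/
def vec {J : ℕ} (A : Matrix (Fin J) (Fin J) ℝ) : Fin J × Fin J → ℝ := fun p => A p.1 p.2

/-- The information matrix at `M` applied to the matrix `V`, the result written as a matrix. -/
def infoApply {J : ℕ} (M V : Matrix (Fin J) (Fin J) ℝ) : Matrix (Fin J) (Fin J) ℝ :=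
  Matrix.of fun i j => (info M).mulVec (vec V) (i, j)

/-- The set of all `L + S` with `L` positive semidefinite and `S` symmetric. -/
def paramSet (J : ℕ) : Set (Matrix (Fin J) (Fin J) ℝ) :=
  {V | ∃ L S : Matrix (Fin J) (Fin J) ℝ, L.PosSemidef ∧ S.IsSymm ∧ V = L + S}

/-- Local identifiability: the information matrix at `M` is positive definite on `paramSet`. -/
def LocallyIdentifiable {J : ℕ} (M : Matrix (Fin J) (Fin J) ℝ) : Prop :=
  ∀ V ∈ paramSet J, 0 ≤ vec V ⬝ᵥ (info M).mulVec (vec V) ∧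
    (vec V ⬝ᵥ (info M).mulVec (vec V) = 0 ↔ V = 0)

/-! ### Tangent spaces and projections -/

/-- Symmetric matrices with the same off-diagonal sparsity as `S₀`. -/
def sparseSpace {J : ℕ} (S₀ : Matrix (Fin J) (Fin J) ℝ) :
    Submodule ℝ (Matrix (Fin J) (Fin J) ℝ) where
  carrier := {S | S.IsSymm ∧ ∀ i j, i ≠ j → S₀ i j = 0 → S i j = 0}
  add_mem' := by
    rintro A B ⟨hA, hA'⟩ ⟨hB, hB'⟩
    exact ⟨hA.add hB, fun i j hij h => by simp [hA' i j hij h, hB' i j hij h]⟩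
  zero_mem' := ⟨Matrix.isSymm_zero, fun _ _ _ _ => rfl⟩
  smul_mem' := by
    rintro c A ⟨hA, hA'⟩
    exact ⟨hA.smul c, fun i j hij h => by simp [hA' i j hij h]⟩

/-- The tangent space `{U Y + Yᵀ Uᵀ}` of the low-rank positive semidefinite matrices at a matrix
whose eigenvectors for positive eigenvalues are the columns of `U`. -/
def tangentSpace {J K : ℕ} (U : Matrix (Fin J) (Fin K) ℝ) :
    Submodule ℝ (Matrix (Fin J) (Fin J) ℝ) where
  carrier := {A | ∃ Y : Matrix (Fin K) (Fin J) ℝ, A = U * Y + Y.transpose * U.transpose}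
  add_mem' := by
    rintro A B ⟨Y, rfl⟩ ⟨Z, rfl⟩
    exact ⟨Y + Z, by rw [Matrix.transpose_add, Matrix.mul_add, Matrix.add_mul]; abel⟩
  zero_mem' := ⟨0, by simp⟩
  smul_mem' := by
    rintro c A ⟨Y, rfl⟩
    exact ⟨c • Y, by simp [smul_add]⟩

/-- Vectorisation as an isomorphism with the Euclidean space `ℝ^{J × J}`; it carries the inner
product `A · B = Trace(A Bᵀ)` to the standard one. -/
def vecEquiv (J : ℕ) : Matrix (Fin J) (Fin J) ℝ ≃ₗ[ℝ] EuclideanSpace ℝ (Fin J × Fin J) where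
  toFun A := WithLp.toLp 2 (vec A)
  invFun v := Matrix.of fun i j => v (i, j)
  map_add' _ _ := rfl
  map_smul' _ _ := rfl
  left_inv _ := rfl
  right_inv _ := rfl

/-- The orthogonal projection of `A` onto `W`, for the inner product `A · B = Trace(A Bᵀ)`. -/
def proj {J : ℕ} (W : Submodule ℝ (Matrix (Fin J) (Fin J) ℝ)) (A : Matrix (Fin J) (Fin J) ℝ) :
    Matrix (Fin J) (Fin J) ℝ :=
  (vecEquiv J).symm ((W.map (vecEquiv J).toLinearMap).starProjection (vecEquiv J A))

/-- The orthogonal projection of `A` onto the orthogonal complement of `W`, for the same inner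
product. -/
def projPerp {J : ℕ} (W : Submodule ℝ (Matrix (Fin J) (Fin J) ℝ))
    (A : Matrix (Fin J) (Fin J) ℝ) : Matrix (Fin J) (Fin J) ℝ :=
  (vecEquiv J).symm ((W.map (vecEquiv J).toLinearMap)ᗮ.starProjection (vecEquiv J A))

/-! ### The irrepresentable condition -/

/-- `sign(O(S))`: the signs of the off-diagonal entries, and zero on the diagonal. -/
def signOffDiag {J : ℕ} (S : Matrix (Fin J) (Fin J) ℝ) : Matrix (Fin J) (Fin J) ℝ :=
  Matrix.of fun i j => if i = j then 0 else Real.sign (S i j)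

/-- The maximum norm. -/
def maxNorm {J : ℕ} (A : Matrix (Fin J) (Fin J) ℝ) : ℝ := ⨆ p : Fin J × Fin J, |A p.1 p.2|

/-- The spectral norm. -/
def spectralNorm {J : ℕ} (A : Matrix (Fin J) (Fin J) ℝ) : ℝ :=
  ‖Matrix.toEuclideanCLM (n := Fin J) (𝕜 := ℝ) A‖

/-- `‖(A, B)‖_ρ = max (‖A‖_∞, ‖B‖₂ / ρ)`. -/
def rhoNorm {J : ℕ} (ρ : ℝ) (p : Matrix (Fin J) (Fin J) ℝ × Matrix (Fin J) (Fin J) ℝ) : ℝ :=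
  max (maxNorm p.1) (spectralNorm p.2 / ρ)

/-- The operator `F(S, L) = (P_𝒮 {I(S + L)}, P_𝒯 {I(S + L)})` for `S ∈ 𝒮`, `L ∈ 𝒯`, where `I` is the
information matrix at `M`. -/
def opF {J : ℕ} (M : Matrix (Fin J) (Fin J) ℝ) (𝒮 𝒯 : Submodule ℝ (Matrix (Fin J) (Fin J) ℝ))
    (p : 𝒮 × 𝒯) : Matrix (Fin J) (Fin J) ℝ × Matrix (Fin J) (Fin J) ℝ :=
  (proj 𝒮 (infoApply M (p.1 + p.2)), proj 𝒯 (infoApply M (p.1 + p.2)))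

/-- The operator `F^⊥(S, L) = (P_{𝒮^⊥} {I(S + L)}, P_{𝒯^⊥} {I(S + L)})` for `S ∈ 𝒮`, `L ∈ 𝒯`. -/
def opFPerp {J : ℕ} (M : Matrix (Fin J) (Fin J) ℝ)
    (𝒮 𝒯 : Submodule ℝ (Matrix (Fin J) (Fin J) ℝ))
    (p : 𝒮 × 𝒯) : Matrix (Fin J) (Fin J) ℝ × Matrix (Fin J) (Fin J) ℝ :=
  (projPerp 𝒮 (infoApply M (p.1 + p.2)), projPerp 𝒯 (infoApply M (p.1 + p.2)))

/-- The irrepresentable condition `‖F^⊥ F⁻¹ (sign(O(S₀)), ρ U Uᵀ)‖_ρ < 1`. The pair `p` is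
`F⁻¹ (sign(O(S₀)), ρ U Uᵀ)`; it is unique under local identifiability and transversality, since
`F` is then injective. -/
def Irrepresentable {J K : ℕ} (M S₀ : Matrix (Fin J) (Fin J) ℝ) (U : Matrix (Fin J) (Fin K) ℝ)
    (ρ : ℝ) : Prop :=
  ∃ p : sparseSpace S₀ × tangentSpace U,
    opF M (sparseSpace S₀) (tangentSpace U) p = (signOffDiag S₀, ρ • (U * U.transpose)) ∧
    rhoNorm ρ (opFPerp M (sparseSpace S₀) (tangentSpace U) p) < 1

/-! ### Sanity checks of the definitions -/

/-- On positive semidefinite matrices the nuclear norm is the trace. -/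
theorem nuclearNorm_eq_trace {J : ℕ} {L : Matrix (Fin J) (Fin J) ℝ} (hL : L.PosSemidef) :
    nuclearNorm L = L.trace := by
  rw [nuclearNorm, dif_pos hL.isHermitian, hL.isHermitian.trace_eq_sum_eigenvalues]
  exact Finset.sum_congr rfl fun i _ => abs_of_nonneg (hL.eigenvalues_nonneg i)

/-- The linear predictor of `X_j` given the other variables. -/
def predictor {J : ℕ} (M : Matrix (Fin J) (Fin J) ℝ) (j : Fin J) (x : Config J) : ℝ :=
  M j j / 2 + ∑ i ∈ Finset.univ.erase j, M i j * toVec x i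

theorem predictor_update {J : ℕ} (M : Matrix (Fin J) (Fin J) ℝ) (j : Fin J) (x : Config J)
    (b : Bool) : predictor M j (Function.update x j b) = predictor M j x := by
  unfold predictor
  congr 1
  refine Finset.sum_congr rfl fun i hi => ?_
  simp [toVec, Function.update_of_ne (Finset.ne_of_mem_erase hi)]

theorem weight_eq {J : ℕ} {M : Matrix (Fin J) (Fin J) ℝ} (hM : M.IsSymm) (j : Fin J)
    (x : Config J) :
    weight M x =
      weight M (Function.update x j false) * Real.exp (predictor M j x * toVec x j) := by
  set y := toVec (Function.update x j false) with hy
  set c := toVec x j with hc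
  have hc2 : c * c = c := by simp [hc, toVec]
  have hx : toVec x = y + c • Pi.single j 1 := by
    ext i
    by_cases h : i = j
    · subst h
      by_cases hb : x i <;> simp [hy, hc, toVec, hb]
    · simp [hy, toVec, h]
  have hp : predictor M j x = M j j / 2 + M.mulVec y j := by
    unfold predictor
    congr 1
    rw [Matrix.mulVec, dotProduct, ← Finset.add_sum_erase _ _ (Finset.mem_univ j)]
    have : y j = 0 := by simp [hy, toVec]
    rw [this, mul_zero, zero_add]
    refine Finset.sum_congr rfl fun i hi => ?_
    have hi' := Finset.ne_of_mem_erase hi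
    rw [hM.apply j i]
    simp [hy, toVec, hi']
  have hs : y ⬝ᵥ M.mulVec (Pi.single j 1) = M.mulVec y j := by
    rw [Matrix.dotProduct_mulVec, ← Matrix.mulVec_transpose, hM.eq, dotProduct_single, mul_one]
  unfold weight
  rw [← Real.exp_add, hx, hp]
  congr 1
  rw [Matrix.mulVec_add, Matrix.mulVec_smul, add_dotProduct, dotProduct_add, dotProduct_add,
    smul_dotProduct, smul_dotProduct, dotProduct_smul, dotProduct_smul, hs]
  simp only [single_one_dotProduct, Matrix.mulVec_single_one, Matrix.col_apply, smul_eq_mul]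
  linear_combination (M j j / 2) * hc2

/-- For symmetric `M`, the conditional likelihood has the logistic closed form. -/
theorem condLik_eq_logistic {J : ℕ} {M : Matrix (Fin J) (Fin J) ℝ} (hM : M.IsSymm) (j : Fin J)
    (x : Config J) :
    condLik M j x = Real.exp (predictor M j x * toVec x j) / (1 + Real.exp (predictor M j x)) := by
  have hw : ∀ y : Config J, 0 < weight M y := fun y => Real.exp_pos _
  have hz : 0 < ∑ y : Config J, weight M y :=
    Finset.sum_pos (fun y _ => hw y) ⟨fun _ => false, Finset.mem_univ _⟩
  have h1 := weight_eq hM j x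
  have h2 := weight_eq hM j (Function.update x j true)
  rw [predictor_update, Function.update_idem] at h2
  have ht : toVec (Function.update x j true) j = 1 := by simp [toVec]
  rw [ht, mul_one] at h2
  unfold condLik pmf
  rw [← Finset.sum_div, div_div_div_cancel_right₀ hz.ne', Fintype.sum_bool, h2, h1]
  have h0 := hw (Function.update x j false)
  rw [div_eq_div_iff (by positivity) (by positivity)]
  ring

end FLaG

end

open FLaG

/-! The loss depends on the sample only through its empirical frequencies `q`, so everything is
proved deterministically for a weighted sample whose weights satisfy `q - p = o(γ)`, with `p` the
true law (`IsRegime`). Probability enters through Chebyshev alone: deviations have scale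
`N^(-1/2+η/2)`, negligible against `γ ~ N^(-1/2+η)`.

Deterministic part. Write `M₀ = L₀ + S₀` and `Q = 1 - U Uᵀ`. The irrepresentable condition supplies
a sparse `A` and a tangent `B` such that `W = I(A + B)` is a strictly feasible dual certificate with
slack `κ` (`exists_certificate`). The score has mean zero at the truth (`wGrad_pmf`), so at `M₀ - γ
(A + B)` the gradient is `-γ W + o(γ)` (`exists_norm_wGrad_add_le`): this point nearly satisfies the
optimality conditions. A second order correction makes its low rank part positive semidefinite
(`exists_posSemidef_correction`). Comparing any solution with the corrected point, through convexity
and the certificate (`IsSolution.basic_inequality`), and using strong monotonicity of the gradient,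
shows that `L + S` is within `o(γ)` of it (`IsRegime.eventually_close`). The gradient at every
solution is then also `-γ W + o(γ)`.

The conclusions are read off from this. Strict feasibility off the support forces zeros of `S`.
Complementary slackness puts the range of `L` in the kernel of `g + δ 1`, with `g` the gradient, and
strict feasibility off the columns of `U` bounds the dimension of that kernel's part by `K`;
semicontinuity gives the reverse rank inequality. Transversality splits closeness of `L + S` into
closeness of `L` and of `S`, which gives consistency and the remaining signs. Two solutions share `L
+ S` by strong monotonicity, hence share the dual variable; it annihilates both low rank parts, so
also their difference, a sparse matrix, and `IsCertificate.exists_injectivity_radius` makes that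
difference zero.

All solutions are treated at once, with no restricted problem. Matrix norms `‖·‖` are largest
absolute entries, whence the factors of `J`. -/

noncomputable section

namespace FLaG

/-! ### Gram factorization of positive semidefinite matrices -/

section Factorization

open scoped MatrixOrder Matrix.Norms.L2Operator

/-- A positive semidefinite real matrix is a Gram matrix. -/
theorem exists_eq_mul_transpose {J : ℕ} {A : Matrix (Fin J) (Fin J) ℝ} (hA : A.PosSemidef) :
    ∃ C : Matrix (Fin J) (Fin J) ℝ, A = C * C.transpose := by
  obtain ⟨B, hB⟩ := CStarAlgebra.nonneg_iff_eq_star_mul_self.mp hA.nonneg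
  exact ⟨B.transpose, by rw [hB, Matrix.transpose_transpose]; rfl⟩

end Factorization

open scoped Matrix.Norms.Elementwise

/-! ### Trace inner product, logistic form of the loss, gradient and information -/

section Likelihood

/-! ### The trace inner product -/

/-- The inner product `A · B = Trace (A Bᵀ)` of two square matrices, as a bilinear map. -/
def ip {J : ℕ} : Matrix (Fin J) (Fin J) ℝ →ₗ[ℝ] Matrix (Fin J) (Fin J) ℝ →ₗ[ℝ] ℝ :=
  LinearMap.mk₂ ℝ (fun A B => ∑ i, ∑ j, A i j * B i j)
    (fun A B C => by simp [add_mul, Finset.sum_add_distrib])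
    (fun c A B => by simp [Finset.mul_sum, mul_assoc])
    (fun A B C => by simp [mul_add, Finset.sum_add_distrib])
    (fun c A B => by simp [Finset.mul_sum, mul_left_comm])

variable {J : ℕ}

theorem ip_apply (A B : Matrix (Fin J) (Fin J) ℝ) : ip A B = ∑ i, ∑ j, A i j * B i j := rfl

theorem ip_comm (A B : Matrix (Fin J) (Fin J) ℝ) : ip A B = ip B A := by
  simp only [ip_apply, mul_comm]

theorem ip_eq_trace (A B : Matrix (Fin J) (Fin J) ℝ) : ip A B = (A.transpose * B).trace := by
  rw [ip_apply, Finset.sum_comm]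
  simp [Matrix.trace, Matrix.mul_apply]

theorem ip_eq_dotProduct (A B : Matrix (Fin J) (Fin J) ℝ) : ip A B = vec A ⬝ᵥ vec B := by
  rw [ip_apply, dotProduct, Fintype.sum_prod_type]
  rfl

theorem ip_one_left (A : Matrix (Fin J) (Fin J) ℝ) : ip 1 A = A.trace := by
  simp [ip_eq_trace]

theorem ip_single (A : Matrix (Fin J) (Fin J) ℝ) (a b : Fin J) :
    ip A (Matrix.single a b 1) = A a b := by
  rw [ip_apply, Finset.sum_eq_single a, Finset.sum_eq_single b]
  · simp
  · intro j _ hj; simp [hj.symm]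
  · simp
  · intro i _ hi; exact Finset.sum_eq_zero fun j _ => by simp [hi.symm]
  · simp

theorem ip_vecMulVec (A : Matrix (Fin J) (Fin J) ℝ) (v : Fin J → ℝ) :
    ip A (Matrix.vecMulVec v v) = v ⬝ᵥ A.mulVec v := by
  rw [ip_apply, dotProduct]
  refine Finset.sum_congr rfl fun i _ => ?_
  rw [Matrix.mulVec, dotProduct, Finset.mul_sum]
  refine Finset.sum_congr rfl fun j _ => ?_
  rw [Matrix.vecMulVec_apply]; ring

theorem ip_transpose (A B : Matrix (Fin J) (Fin J) ℝ) :
    ip A.transpose B = ip A B.transpose := by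
  rw [ip_apply, ip_apply, Finset.sum_comm]; rfl

theorem abs_entry_le (A : Matrix (Fin J) (Fin J) ℝ) (i j : Fin J) : |A i j| ≤ ‖A‖ :=
  Matrix.norm_entry_le_entrywise_sup_norm A

theorem norm_le_of_entries {A : Matrix (Fin J) (Fin J) ℝ} {r : ℝ} (hr : 0 ≤ r)
    (h : ∀ i j, |A i j| ≤ r) : ‖A‖ ≤ r :=
  (Matrix.norm_le_iff hr).2 h

theorem abs_ip_le (A B : Matrix (Fin J) (Fin J) ℝ) : |ip A B| ≤ (J : ℝ) ^ 2 * (‖A‖ * ‖B‖) := by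
  rw [ip_apply]
  calc |∑ i, ∑ j, A i j * B i j| ≤ ∑ i, ∑ j, |A i j * B i j| :=
        (Finset.abs_sum_le_sum_abs _ _).trans
          (Finset.sum_le_sum fun i _ => Finset.abs_sum_le_sum_abs _ _)
    _ ≤ ∑ _i : Fin J, ∑ _j : Fin J, ‖A‖ * ‖B‖ := by
        refine Finset.sum_le_sum fun i _ => Finset.sum_le_sum fun j _ => ?_
        rw [abs_mul]
        exact mul_le_mul (abs_entry_le A i j) (abs_entry_le B i j) (abs_nonneg _) (norm_nonneg _)
    _ = (J : ℝ) ^ 2 * (‖A‖ * ‖B‖) := by simp; ring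

theorem ip_mul_transpose_eq (A B : Matrix (Fin J) (Fin J) ℝ) :
    ip A (B * B.transpose) = (B.transpose * A * B).trace := by
  rw [ip_comm, ip_eq_trace, Matrix.transpose_mul, Matrix.transpose_transpose, Matrix.mul_assoc,
    Matrix.trace_mul_comm]

/-- The inner product of two positive semidefinite matrices is nonnegative. -/
theorem ip_nonneg_of_posSemidef {A B : Matrix (Fin J) (Fin J) ℝ} (hA : A.PosSemidef)
    (hB : B.PosSemidef) : 0 ≤ ip A B := by
  obtain ⟨C, rfl⟩ := exists_eq_mul_transpose hB
  rw [ip_mul_transpose_eq]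
  exact (hA.conjTranspose_mul_mul_same C).trace_nonneg

/-- Positive semidefinite matrices with inner product zero have product zero. -/
theorem mul_eq_zero_of_ip_eq_zero {A B : Matrix (Fin J) (Fin J) ℝ} (hA : A.PosSemidef)
    (hB : B.PosSemidef) (h : ip A B = 0) : A * B = 0 := by
  obtain ⟨C, rfl⟩ := exists_eq_mul_transpose hB
  rw [ip_mul_transpose_eq] at h
  have hp : (C.transpose * A * C).PosSemidef := hA.conjTranspose_mul_mul_same C
  have h0 := hp.trace_eq_zero_iff.1 h
  -- The diagonal entries of `Cᵀ A C` are the values of the form of `A` at the columns of `C`; a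
  -- vector on which a positive semidefinite form vanishes is in its kernel.
  have hcol : A * C = 0 := by
    ext i k
    have hk : (C.transpose * A * C) k k = 0 := by rw [h0]; rfl
    have : star (fun j => C j k) ⬝ᵥ A.mulVec (fun j => C j k) = 0 := by
      rw [← hk, Matrix.mul_assoc]
      rfl
    exact congrFun ((hA.dotProduct_mulVec_zero_iff _).1 this) i
  rw [← Matrix.mul_assoc, hcol, Matrix.zero_mul]

/-- The entries of a positive semidefinite matrix are bounded by its trace. -/
theorem norm_le_trace {A : Matrix (Fin J) (Fin J) ℝ} (hA : A.PosSemidef) : ‖A‖ ≤ A.trace := by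
  refine norm_le_of_entries hA.trace_nonneg fun i j => ?_
  have hd : ∀ i, 0 ≤ A i i := fun i => hA.diag_nonneg
  have hs : A j i = A i j := by simpa using hA.isHermitian.apply i j
  -- The form at `e_i ± e_j` gives `2 |A i j| ≤ A i i + A j j`.
  have key : ∀ c : ℝ, c * c = 1 → 0 ≤ A i i + 2 * (c * A i j) + A j j := by
    intro c hc
    have h := hA.dotProduct_mulVec_nonneg (Pi.single i 1 + c • Pi.single j 1)
    simp only [star_trivial, Matrix.mulVec_add, Matrix.mulVec_smul, Matrix.mulVec_single_one,
      add_dotProduct, smul_dotProduct, dotProduct_add, dotProduct_smul, single_one_dotProduct,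
      Matrix.col_apply, smul_eq_mul, hs] at h
    linear_combination h + (A j j) * hc
  have h1 := key 1 (by norm_num)
  have h2 := key (-1) (by norm_num)
  by_cases hij : i = j
  · subst hij
    rw [abs_of_nonneg (hd i)]
    exact Finset.single_le_sum (f := fun i => A i i) (fun i _ => hd i) (Finset.mem_univ i)
  · have : A i i + A j j ≤ A.trace := by
      rw [← Finset.sum_pair (f := fun i => A i i) hij]
      exact Finset.sum_le_sum_of_subset_of_nonneg (Finset.subset_univ _) fun i _ _ => hd i
    rw [abs_le]
    have := hd i
    have := hd j
    constructor <;> linarith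

/-! ### The logistic closed form of the pseudo-likelihood -/

/-- The symmetric matrix representing the linear predictor of the `j`-th variable at `x`. -/
def design (j : Fin J) (x : Config J) : Matrix (Fin J) (Fin J) ℝ :=
  Matrix.of fun a b => ((if a = j then if b = j then 1 / 2 else toVec x b else 0) +
    (if b = j then if a = j then 1 / 2 else toVec x a else 0)) / 2

theorem design_isSymm (j : Fin J) (x : Config J) : (design j x).IsSymm := by
  ext a b
  simp [design, add_comm]

theorem ip_design {M : Matrix (Fin J) (Fin J) ℝ} (hM : M.IsSymm) (j : Fin J) (x : Config J) :
    ip (design j x) M = predictor M j x := by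
  set A : Matrix (Fin J) (Fin J) ℝ :=
    Matrix.of fun a b => if a = j then if b = j then 1 / 2 else toVec x b else 0 with hA
  have hD : design j x = (1 / 2 : ℝ) • (A + A.transpose) := by
    ext a b
    simp [design, A]; ring
  have h : ip A M = predictor M j x := by
    rw [ip_apply, Finset.sum_eq_single j (fun i _ hi => by simp [A, hi]) (by simp),
      ← Finset.add_sum_erase _ _ (Finset.mem_univ j), predictor]
    congr 1
    · simp [A]; ring
    · refine Finset.sum_congr rfl fun i hi => ?_
      rw [hM.apply]
      simp [A, Finset.ne_of_mem_erase hi, mul_comm]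
  rw [hD, map_smul, map_add, LinearMap.smul_apply, LinearMap.add_apply, ip_transpose, hM.eq, h,
    smul_eq_mul]
  ring

theorem abs_design_le (j : Fin J) (x : Config J) : ‖design j x‖ ≤ 1 := by
  refine norm_le_of_entries zero_le_one fun a b => ?_
  have h : ∀ c, toVec x c = 0 ∨ toVec x c = 1 := fun c => by
    unfold toVec; by_cases hc : x c <;> simp [hc]
  unfold design
  rw [Matrix.of_apply, abs_le]
  rcases h a with ha | ha <;> rcases h b with hb | hb <;> rw [ha, hb] <;> split_ifs <;> norm_num

theorem design_update (j : Fin J) (x : Config J) (b : Bool) :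
    design j (Function.update x j b) = design j x := by
  ext a c
  simp only [design, toVec, Matrix.of_apply]
  by_cases ha : a = j <;> by_cases hc : c = j <;> simp [ha, hc]

/-- A quadratic form sees only the symmetric part. This is needed because `info` differentiates in
the directions of single entries, which leave the symmetric matrices, while the logistic form was
derived for symmetric `M`. -/
theorem weight_symm (M : Matrix (Fin J) (Fin J) ℝ) (x : Config J) :
    weight M x = weight ((1 / 2 : ℝ) • (M + M.transpose)) x := by
  unfold weight
  rw [Matrix.smul_mulVec, Matrix.add_mulVec, dotProduct_smul, dotProduct_add,
    Matrix.mulVec_transpose, dotProduct_comm (toVec x) (Matrix.vecMul (toVec x) M),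
    ← Matrix.dotProduct_mulVec, smul_eq_mul]
  ring_nf

theorem symmetrization_isSymm (M : Matrix (Fin J) (Fin J) ℝ) :
    ((1 / 2 : ℝ) • (M + M.transpose)).IsSymm := by
  simp [Matrix.IsSymm, add_comm]

theorem ip_symmetrization {A : Matrix (Fin J) (Fin J) ℝ} (hA : A.IsSymm)
    (M : Matrix (Fin J) (Fin J) ℝ) : ip A ((1 / 2 : ℝ) • (M + M.transpose)) = ip A M := by
  rw [map_smul, map_add, ← ip_transpose, hA.eq, smul_eq_mul]; ring

/-- The logistic form of the conditional likelihood, at a matrix that need not be symmetric. -/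
theorem condLik_eq (M : Matrix (Fin J) (Fin J) ℝ) (j : Fin J) (x : Config J) :
    condLik M j x =
      Real.exp (ip (design j x) M * toVec x j) / (1 + Real.exp (ip (design j x) M)) := by
  have h : condLik M j x = condLik ((1 / 2 : ℝ) • (M + M.transpose)) j x := by
    simp only [condLik, pmf, weight_symm M]
  rw [h, condLik_eq_logistic (symmetrization_isSymm M), ← ip_design (symmetrization_isSymm M),
    ip_symmetrization (design_isSymm j x)]

/-- The softplus function `log (1 + exp t)`. -/
def softplus (t : ℝ) : ℝ := Real.log (1 + Real.exp t)

theorem condLik_pos (M : Matrix (Fin J) (Fin J) ℝ) (j : Fin J) (x : Config J) :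
    0 < condLik M j x := by
  rw [condLik_eq]; positivity

theorem neg_log_condLik (M : Matrix (Fin J) (Fin J) ℝ) (j : Fin J) (x : Config J) :
    -Real.log (condLik M j x) =
      softplus (ip (design j x) M) - toVec x j * ip (design j x) M := by
  rw [condLik_eq, Real.log_div (by positivity) (by positivity), Real.log_exp, softplus]
  ring

/-- The negative log-pseudo-likelihood of the weighted sample in which `x` has weight `q x`. -/
def wLoss (q : Config J → ℝ) (M : Matrix (Fin J) (Fin J) ℝ) : ℝ :=
  ∑ x, q x * ∑ j, (softplus (ip (design j x) M) - toVec x j * ip (design j x) M)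

/-- The empirical frequencies of a sample. -/
def empFreq {N : ℕ} (x : Fin N → Config J) (y : Config J) : ℝ :=
  1 / (N : ℝ) * ∑ i, if x i = y then 1 else 0

theorem empFreq_sum {N : ℕ} (x : Fin N → Config J) (F : Config J → ℝ) :
    ∑ y, empFreq x y * F y = 1 / (N : ℝ) * ∑ i, F (x i) := by
  simp only [empFreq, mul_assoc, ← Finset.mul_sum, Finset.sum_mul]
  rw [Finset.sum_comm]
  simp

theorem negLogPL_eq {N : ℕ} (x : Fin N → Config J) (M : Matrix (Fin J) (Fin J) ℝ) :
    negLogPL x M = wLoss (empFreq x) M := by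
  rw [wLoss, empFreq_sum, negLogPL, pseudoLik,
    Real.log_prod (fun i _ => (Finset.prod_pos fun j _ => condLik_pos M j (x i)).ne'),
    neg_mul, ← mul_neg, ← Finset.sum_neg_distrib]
  congr 1
  refine Finset.sum_congr rfl fun i _ => ?_
  rw [Real.log_prod (fun j _ => (condLik_pos M j (x i)).ne'), ← Finset.sum_neg_distrib]
  exact Finset.sum_congr rfl fun j _ => neg_log_condLik M j (x i)

/-! ### Derivatives -/

theorem one_sub_sigmoid (t : ℝ) : 1 - Real.sigmoid t = (1 + Real.exp t)⁻¹ := by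
  rw [← Real.sigmoid_neg, Real.sigmoid_def, neg_neg]

theorem sigmoid_eq_exp (t : ℝ) : Real.sigmoid t = Real.exp t / (1 + Real.exp t) := by
  have h := one_sub_sigmoid t
  have : 1 + Real.exp t ≠ 0 := by positivity
  field_simp at h ⊢
  linarith

theorem hasDerivAt_softplus (t : ℝ) : HasDerivAt softplus (Real.sigmoid t) t := by
  rw [sigmoid_eq_exp]
  exact ((Real.hasDerivAt_exp t).const_add 1).log (by positivity)

/-- The gradient of `wLoss q` at `M`. -/
def wGrad (q : Config J → ℝ) (M : Matrix (Fin J) (Fin J) ℝ) : Matrix (Fin J) (Fin J) ℝ :=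
  ∑ x, ∑ j, (q x * (Real.sigmoid (ip (design j x) M) - toVec x j)) • design j x

theorem ip_wGrad (q : Config J → ℝ) (M V : Matrix (Fin J) (Fin J) ℝ) :
    ip (wGrad q M) V = ∑ x, ∑ j,
      q x * (Real.sigmoid (ip (design j x) M) - toVec x j) * ip (design j x) V := by
  simp [wGrad, LinearMap.sum_apply]

theorem wGrad_isSymm (q : Config J → ℝ) (M : Matrix (Fin J) (Fin J) ℝ) :
    (wGrad q M).IsSymm := by
  simp only [Matrix.IsSymm, wGrad, Matrix.transpose_sum, Matrix.transpose_smul,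
    (design_isSymm _ _).eq]

theorem hasDerivAt_wLoss (q : Config J → ℝ) (M V : Matrix (Fin J) (Fin J) ℝ) (s : ℝ) :
    HasDerivAt (fun t : ℝ => wLoss q (M + t • V)) (ip (wGrad q (M + s • V)) V) s := by
  rw [ip_wGrad]
  unfold wLoss
  refine HasDerivAt.fun_sum fun x _ => ?_
  simp only [mul_assoc, ← Finset.mul_sum]
  refine HasDerivAt.const_mul _ (HasDerivAt.fun_sum fun j _ => ?_)
  have hl : HasDerivAt (fun t : ℝ => ip (design j x) (M + t • V)) (ip (design j x) V) s := by
    simp only [map_add, map_smul, smul_eq_mul]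
    simpa using ((hasDerivAt_id s).mul_const (ip (design j x) V)).const_add (ip (design j x) M)
  rw [sub_mul]
  exact ((hasDerivAt_softplus _).comp s hl).sub (hl.const_mul _)

/-- Each term depends on `M` through one linear predictor, and the response enters linearly, so it
drops out of the second derivative: what remains is the logistic variance times a product of design
entries. -/
theorem partialDeriv₂_negLogPL (x : Config J) (M : Matrix (Fin J) (Fin J) ℝ)
    (p q : Fin J × Fin J) :
    partialDeriv₂ (negLogPL (fun _ : Fin 1 => x)) M p q =
      ∑ j, Real.sigmoid (ip (design j x) M) * (1 - Real.sigmoid (ip (design j x) M)) *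
        design j x p.1 p.2 * design j x q.1 q.2 := by
  have hf : negLogPL (fun _ : Fin 1 => x) = wLoss (empFreq fun _ : Fin 1 => x) :=
    funext (negLogPL_eq _)
  have hfirst : ∀ s : ℝ, deriv (fun t : ℝ => negLogPL (fun _ : Fin 1 => x)
      (M + s • Matrix.single p.1 p.2 1 + t • Matrix.single q.1 q.2 1)) 0 =
      ∑ j, (Real.sigmoid (ip (design j x) M + s * design j x p.1 p.2) - toVec x j) *
        design j x q.1 q.2 := by
    intro s
    rw [hf, (hasDerivAt_wLoss _ _ _ _).deriv, ip_wGrad]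
    simp only [mul_assoc, ← Finset.mul_sum]
    rw [empFreq_sum]
    simp [ip_single, -Matrix.smul_single]
  unfold partialDeriv₂
  simp only [hfirst]
  refine HasDerivAt.deriv (HasDerivAt.fun_sum fun j _ => ?_)
  have hl : HasDerivAt (fun s : ℝ => ip (design j x) M + s * design j x p.1 p.2)
      (design j x p.1 p.2) 0 := by
    simpa using ((hasDerivAt_id (0 : ℝ)).mul_const (design j x p.1 p.2)).const_add
      (ip (design j x) M)
  have h := Real.hasDerivAt_sigmoid (ip (design j x) M + 0 * design j x p.1 p.2)
  have := ((h.comp (0 : ℝ) hl).sub_const (toVec x j)).mul_const (design j x q.1 q.2)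
  simpa using this

theorem infoApply_eq (M V : Matrix (Fin J) (Fin J) ℝ) :
    infoApply M V = ∑ x, ∑ j, (pmf M x * (Real.sigmoid (ip (design j x) M) *
      (1 - Real.sigmoid (ip (design j x) M)) * ip (design j x) V)) • design j x := by
  ext a b
  simp only [infoApply, Matrix.of_apply, Matrix.mulVec, dotProduct, info,
    partialDeriv₂_negLogPL, Matrix.sum_apply, Matrix.smul_apply, smul_eq_mul]
  simp only [Finset.sum_mul, Finset.mul_sum]
  rw [Finset.sum_comm]
  refine Finset.sum_congr rfl fun x _ => ?_
  rw [Finset.sum_comm]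
  refine Finset.sum_congr rfl fun j _ => ?_
  rw [ip_eq_dotProduct _ V, dotProduct, Finset.mul_sum, Finset.mul_sum, Finset.sum_mul]
  refine Finset.sum_congr rfl fun p _ => ?_
  simp only [vec]
  ring

theorem infoApply_isSymm (M V : Matrix (Fin J) (Fin J) ℝ) : (infoApply M V).IsSymm := by
  rw [infoApply_eq]
  simp only [Matrix.IsSymm, Matrix.transpose_sum, Matrix.transpose_smul, (design_isSymm _ _).eq]

end Likelihood

/-! ### Quantitative convexity, coercivity and expansion of the loss -/

section Estimates

variable {J : ℕ}

/-! ### Scalar estimates for the logistic function -/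

theorem exists_sigmoid_sub_eq (s t : ℝ) : ∃ ξ ∈ Set.uIcc s t,
    Real.sigmoid s - Real.sigmoid t = Real.sigmoid ξ * (1 - Real.sigmoid ξ) * (s - t) := by
  have key : ∀ a b : ℝ, a < b → ∃ ξ ∈ Set.uIcc a b,
      Real.sigmoid b - Real.sigmoid a = Real.sigmoid ξ * (1 - Real.sigmoid ξ) * (b - a) := by
    intro a b hab
    obtain ⟨ξ, hξ, h⟩ := exists_hasDerivAt_eq_slope Real.sigmoid _ hab
      continuous_sigmoid.continuousOn (fun x _ => Real.hasDerivAt_sigmoid x)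
    refine ⟨ξ, Set.Icc_subset_uIcc (Set.Ioo_subset_Icc_self hξ), ?_⟩
    rw [h, div_mul_cancel₀ _ (sub_pos.2 hab).ne']
  rcases lt_trichotomy s t with h | h | h
  · obtain ⟨ξ, hξ, e⟩ := key s t h
    exact ⟨ξ, hξ, by linarith⟩
  · exact ⟨s, Set.left_mem_uIcc, by simp [h]⟩
  · obtain ⟨ξ, hξ, e⟩ := key t s h
    exact ⟨ξ, Set.uIcc_comm t s ▸ hξ, e⟩

theorem sigmoid_mul_nonneg (t : ℝ) : 0 ≤ Real.sigmoid t * (1 - Real.sigmoid t) :=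
  mul_nonneg (Real.sigmoid_nonneg t) (sub_nonneg.2 (Real.sigmoid_le_one t))

theorem sigmoid_mul_le_one (t : ℝ) : Real.sigmoid t * (1 - Real.sigmoid t) ≤ 1 := by
  have := Real.sigmoid_nonneg t
  have := Real.sigmoid_le_one t
  nlinarith

theorem abs_sub_le_of_mem_uIcc {s t ξ : ℝ} (h : ξ ∈ Set.uIcc s t) : |ξ - t| ≤ |s - t| := by
  rw [abs_sub_comm]
  exact Set.abs_sub_right_of_mem_uIcc h |>.trans_eq (abs_sub_comm _ _)

theorem abs_sigmoid_sub_le (s t : ℝ) : |Real.sigmoid s - Real.sigmoid t| ≤ |s - t| := by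
  obtain ⟨ξ, -, h⟩ := exists_sigmoid_sub_eq s t
  rw [h, abs_mul, abs_of_nonneg (sigmoid_mul_nonneg ξ)]
  exact mul_le_of_le_one_left (abs_nonneg _) (sigmoid_mul_le_one ξ)

/-- First order expansion of the logistic function with a quadratic remainder. -/
theorem abs_sigmoid_remainder_le (s t : ℝ) :
    |Real.sigmoid s - Real.sigmoid t - Real.sigmoid t * (1 - Real.sigmoid t) * (s - t)| ≤
      (s - t) ^ 2 := by
  obtain ⟨ξ, hξ, h⟩ := exists_sigmoid_sub_eq s t
  -- The identity `a(1-a) - b(1-b) = (a-b)(1-a-b)` controls the variation of the derivative, so no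
  -- second derivative is needed.
  have e : Real.sigmoid s - Real.sigmoid t - Real.sigmoid t * (1 - Real.sigmoid t) * (s - t) =
      (Real.sigmoid ξ - Real.sigmoid t) * (1 - Real.sigmoid ξ - Real.sigmoid t) * (s - t) := by
    rw [h]; ring
  have h1 : |Real.sigmoid ξ - Real.sigmoid t| ≤ |s - t| :=
    (abs_sigmoid_sub_le ξ t).trans (abs_sub_le_of_mem_uIcc hξ)
  have h2 : |1 - Real.sigmoid ξ - Real.sigmoid t| ≤ 1 := by
    have := Real.sigmoid_nonneg t
    have := Real.sigmoid_le_one t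
    have := Real.sigmoid_nonneg ξ
    have := Real.sigmoid_le_one ξ
    rw [abs_le]; constructor <;> linarith
  rw [e, abs_mul, abs_mul, ← sq_abs (s - t), sq]
  gcongr
  calc _ ≤ |s - t| * 1 := by gcongr
    _ = _ := mul_one _

/-- The logistic function is strongly monotone on bounded intervals. -/
theorem sigmoid_strongly_monotone {B s t : ℝ} (hs : |s| ≤ B) (ht : |t| ≤ B) :
    Real.sigmoid (-B) ^ 2 * (s - t) ^ 2 ≤ (Real.sigmoid s - Real.sigmoid t) * (s - t) := by
  obtain ⟨ξ, hξ, h⟩ := exists_sigmoid_sub_eq s t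
  have hB : ξ ∈ Set.Icc (-B) B :=
    (Set.uIcc_subset_Icc (abs_le.1 hs) (abs_le.1 ht)) hξ
  -- The derivative is `σ(ξ) σ(-ξ)`, and both factors are at least `σ(-B)`.
  have h1 : Real.sigmoid (-B) ≤ Real.sigmoid ξ := Real.sigmoid_le hB.1
  have h2 : Real.sigmoid (-B) ≤ 1 - Real.sigmoid ξ := by
    rw [← Real.sigmoid_neg]; exact Real.sigmoid_le (neg_le_neg hB.2)
  rw [h, mul_assoc, ← sq, sq (Real.sigmoid (-B))]
  gcongr
  · exact Real.sigmoid_nonneg _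
  · exact Real.sigmoid_nonneg _

theorem softplus_nonneg (t : ℝ) : 0 ≤ softplus t :=
  Real.log_nonneg (by linarith [Real.exp_pos t])

theorem le_softplus (t : ℝ) : t ≤ softplus t := by
  rw [softplus, Real.le_log_iff_exp_le (by positivity)]
  linarith

/-- The right side is `softplus t + softplus (-t)`, the total loss over the two values of the
response; it makes the loss coercive. -/
theorem abs_le_softplus (t : ℝ) : |t| ≤ 2 * softplus t - t := by
  rw [abs_le]
  have := softplus_nonneg t
  have := le_softplus t
  constructor <;> linarith

theorem continuous_softplus : Continuous softplus :=
  continuous_iff_continuousAt.2 fun t => (hasDerivAt_softplus t).continuousAt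

theorem toVec_eq_zero_or_one (x : Config J) (j : Fin J) : toVec x j = 0 ∨ toVec x j = 1 := by
  unfold toVec; by_cases h : x j <;> simp [h]

theorem softplus_sub_nonneg (x : Config J) (j : Fin J) (t : ℝ) :
    0 ≤ softplus t - toVec x j * t := by
  have := softplus_nonneg t
  have := le_softplus t
  rcases toVec_eq_zero_or_one x j with h | h <;> rw [h] <;> linarith

theorem abs_sigmoid_sub_toVec_le (x : Config J) (j : Fin J) (t : ℝ) :
    |Real.sigmoid t - toVec x j| ≤ 1 := by
  have := Real.sigmoid_nonneg t
  have := Real.sigmoid_le_one t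
  rw [abs_le]
  rcases toVec_eq_zero_or_one x j with h | h <;> rw [h] <;> constructor <;> linarith

/-! ### The probability mass function and the score -/

theorem weight_pos (M : Matrix (Fin J) (Fin J) ℝ) (x : Config J) : 0 < weight M x :=
  Real.exp_pos _

theorem weight_sum_pos (M : Matrix (Fin J) (Fin J) ℝ) : 0 < ∑ y : Config J, weight M y :=
  Finset.sum_pos (fun y _ => weight_pos M y) ⟨fun _ => false, Finset.mem_univ _⟩

theorem pmf_pos (M : Matrix (Fin J) (Fin J) ℝ) (x : Config J) : 0 < pmf M x :=
  div_pos (weight_pos M x) (weight_sum_pos M)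

theorem pmf_le_one (M : Matrix (Fin J) (Fin J) ℝ) (x : Config J) : pmf M x ≤ 1 :=
  (div_le_one (weight_sum_pos M)).2
    (Finset.single_le_sum (fun y _ => (weight_pos M y).le) (Finset.mem_univ x))

/-- The configuration with the `j`-th coordinate flipped. -/
def flipAt (j : Fin J) (x : Config J) : Config J := Function.update x j (!x j)

theorem flip_flip (j : Fin J) (x : Config J) : flipAt j (flipAt j x) = x := by
  simp [flipAt]

theorem flip_ne (j : Fin J) (x : Config J) : flipAt j x ≠ x := by
  intro h
  have := congrFun h j
  simp [flipAt] at this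

theorem design_flip (j : Fin J) (x : Config J) : design j (flipAt j x) = design j x :=
  design_update j x _

theorem toVec_flip (j : Fin J) (x : Config J) : toVec (flipAt j x) j = 1 - toVec x j := by
  unfold toVec flipAt; by_cases h : x j <;> simp [h]

theorem pmf_eq_mul_condLik (M : Matrix (Fin J) (Fin J) ℝ) (j : Fin J) (x : Config J) :
    pmf M x = (pmf M x + pmf M (flipAt j x)) * condLik M j x := by
  have h : ∑ b : Bool, pmf M (Function.update x j b) = pmf M x + pmf M (flipAt j x) := by
    rw [Fintype.sum_bool, flipAt]
    cases h : x j
    · rw [← h, Function.update_eq_self, h, add_comm]; rfl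
    · rw [← h, Function.update_eq_self, h]; rfl
  have := pmf_pos M x
  have := pmf_pos M (flipAt j x)
  rw [condLik, h, mul_div_cancel₀ _ (by positivity)]

/-- Given the other coordinates, `X_j` is Bernoulli with mean the sigmoid of the predictor, so its
residual averages to zero over `x` and its flip, which have the same predictor. -/
theorem pmf_score_flip (M : Matrix (Fin J) (Fin J) ℝ) (j : Fin J) (x : Config J) :
    pmf M x * (Real.sigmoid (ip (design j x) M) - toVec x j) +
      pmf M (flipAt j x) * (Real.sigmoid (ip (design j x) M) - toVec (flipAt j x) j) = 0 := by
  have h := pmf_eq_mul_condLik M j x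
  have h' : Real.exp (ip (design j x) M * toVec x j) / (1 + Real.exp (ip (design j x) M)) =
      1 - toVec x j + (2 * toVec x j - 1) * Real.sigmoid (ip (design j x) M) := by
    rcases toVec_eq_zero_or_one x j with h0 | h0 <;> rw [h0]
    · have := one_sub_sigmoid (ip (design j x) M)
      rw [mul_zero, Real.exp_zero, one_div]; linarith
    · rw [mul_one, ← sigmoid_eq_exp]; ring
  rw [condLik_eq, h'] at h
  rw [toVec_flip]
  rcases toVec_eq_zero_or_one x j with h0 | h0 <;> rw [h0] at h ⊢
  · linear_combination h
  · linear_combination -h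

/-- The score of the pseudo-likelihood has mean zero at the true parameter. -/
theorem wGrad_pmf (M : Matrix (Fin J) (Fin J) ℝ) : wGrad (pmf M) M = 0 := by
  rw [wGrad, Finset.sum_comm]
  refine Finset.sum_eq_zero fun j _ => ?_
  refine Finset.sum_involution (fun x _ => flipAt j x) ?_ (fun x _ _ => flip_ne j x)
    (fun _ _ => Finset.mem_univ _) (fun x _ => flip_flip j x)
  intro x _
  rw [design_flip, ← add_smul, pmf_score_flip, zero_smul]

/-! ### Strong monotonicity, coercivity and expansion of the gradient -/

/-- The zero configuration reads off `V j j / 2`, and the configuration with a single one at `i`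
reads off `V j j / 2 + V i j`. The predictors thus determine a symmetric matrix, which is the source
of strong monotonicity and of coercivity. -/
theorem norm_le_of_abs_ip_design_le {V : Matrix (Fin J) (Fin J) ℝ} (hV : V.IsSymm) {r : ℝ}
    (hr : 0 ≤ r) (h : ∀ j x, |ip (design j x) V| ≤ r) : ‖V‖ ≤ 2 * r := by
  refine norm_le_of_entries (by positivity) fun i j => ?_
  have h0 := h j (fun _ => false)
  have h1 := h j (Function.update (fun _ => false) i true)
  rw [ip_design hV] at h0 h1
  have e0 : predictor V j (fun _ => false) = V j j / 2 := by simp [predictor, toVec]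
  rw [e0] at h0
  by_cases hij : i = j
  · subst hij
    rw [abs_div, abs_two] at h0
    linarith
  · have e1 : predictor V j (Function.update (fun _ => false) i true) = V j j / 2 + V i j := by
      rw [predictor, Finset.sum_eq_single i]
      · simp [toVec]
      · intro k _ hk; simp [toVec, Function.update_of_ne hk]
      · intro hi; exact absurd (Finset.mem_erase.2 ⟨hij, Finset.mem_univ i⟩) hi
    rw [e1] at h1
    rw [abs_le] at *
    constructor <;> linarith [h0.1, h0.2, h1.1, h1.2]

theorem abs_ip_design_le (j : Fin J) (x : Config J) (V : Matrix (Fin J) (Fin J) ℝ) :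
    |ip (design j x) V| ≤ (J : ℝ) ^ 2 * ‖V‖ := by
  refine (abs_ip_le _ _).trans ?_
  gcongr
  exact mul_le_of_le_one_left (norm_nonneg _) (abs_design_le j x)

/-- The gradient is strongly monotone on bounded sets, uniformly in weights that are bounded
below. -/
theorem exists_wGrad_strongly_monotone (B : ℝ) {c₀ : ℝ} (hc₀ : 0 < c₀) :
    ∃ c : ℝ, 0 < c ∧ ∀ (q : Config J → ℝ), (∀ x, c₀ ≤ q x) →
      ∀ M₁ M₂ : Matrix (Fin J) (Fin J) ℝ, M₁.IsSymm → M₂.IsSymm → ‖M₁‖ ≤ B → ‖M₂‖ ≤ B →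
        c * ‖M₁ - M₂‖ ^ 2 ≤ ip (wGrad q M₁ - wGrad q M₂) (M₁ - M₂) := by
  set m := Real.sigmoid (-((J : ℝ) ^ 2 * B)) ^ 2 with hm
  have hm0 : 0 < m := by have := Real.sigmoid_pos (-((J : ℝ) ^ 2 * B)); positivity
  -- Here `m` bounds the logistic slope below on predictors of size `J² B`, and `4` is the square of
  -- the factor in `norm_le_of_abs_ip_design_le`.
  refine ⟨c₀ * m / 4, by positivity, fun q hq M₁ M₂ h₁ h₂ hB₁ hB₂ => ?_⟩
  set D : ℝ := ∑ x : Config J, ∑ j, ip (design j x) (M₁ - M₂) ^ 2 with hD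
  have hD0 : 0 ≤ D := Finset.sum_nonneg fun x _ => Finset.sum_nonneg fun j _ => sq_nonneg _
  have hn : ‖M₁ - M₂‖ ≤ 2 * Real.sqrt D := by
    refine norm_le_of_abs_ip_design_le (h₁.sub h₂) (Real.sqrt_nonneg _) fun j x => ?_
    refine Real.abs_le_sqrt ?_
    calc ip (design j x) (M₁ - M₂) ^ 2 ≤ ∑ j, ip (design j x) (M₁ - M₂) ^ 2 :=
          Finset.single_le_sum (f := fun j => ip (design j x) (M₁ - M₂) ^ 2)
            (fun j _ => sq_nonneg _) (Finset.mem_univ j)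
      _ ≤ D := Finset.single_le_sum
            (f := fun x : Config J => ∑ j, ip (design j x) (M₁ - M₂) ^ 2)
            (fun x _ => Finset.sum_nonneg fun j _ => sq_nonneg _) (Finset.mem_univ x)
  have hn2 : ‖M₁ - M₂‖ ^ 2 ≤ 4 * D := by
    calc ‖M₁ - M₂‖ ^ 2 ≤ (2 * Real.sqrt D) ^ 2 := by gcongr
      _ = 4 * D := by rw [mul_pow, Real.sq_sqrt hD0]; norm_num
  calc c₀ * m / 4 * ‖M₁ - M₂‖ ^ 2 ≤ c₀ * m / 4 * (4 * D) := by gcongr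
    _ = ∑ x : Config J, ∑ j, c₀ * (m * ip (design j x) (M₁ - M₂) ^ 2) := by
        rw [hD]; simp only [← Finset.mul_sum]; ring
    _ ≤ _ := by
        rw [map_sub ip, LinearMap.sub_apply, ip_wGrad, ip_wGrad, ← Finset.sum_sub_distrib]
        refine Finset.sum_le_sum fun x _ => ?_
        rw [← Finset.sum_sub_distrib]
        refine Finset.sum_le_sum fun j _ => ?_
        have hs : ∀ M : Matrix (Fin J) (Fin J) ℝ, ‖M‖ ≤ B →
            |ip (design j x) M| ≤ (J : ℝ) ^ 2 * B := fun M hM =>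
          (abs_ip_design_le j x M).trans (by gcongr)
        have hmono := sigmoid_strongly_monotone (hs M₁ hB₁) (hs M₂ hB₂)
        rw [← hm] at hmono
        have e : ip (design j x) (M₁ - M₂) = ip (design j x) M₁ - ip (design j x) M₂ :=
          map_sub _ _ _
        rw [e]
        calc c₀ * (m * (ip (design j x) M₁ - ip (design j x) M₂) ^ 2)
            ≤ q x * ((Real.sigmoid (ip (design j x) M₁) - Real.sigmoid (ip (design j x) M₂)) *
              (ip (design j x) M₁ - ip (design j x) M₂)) :=
              mul_le_mul (hq x) hmono (by positivity) (hc₀.le.trans (hq x))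
          _ = _ := by ring

theorem wLoss_mono {q q' : Config J → ℝ} (h : ∀ x, q x ≤ q' x) (M : Matrix (Fin J) (Fin J) ℝ) :
    wLoss q M ≤ wLoss q' M := by
  refine Finset.sum_le_sum fun x _ => mul_le_mul_of_nonneg_right (h x) ?_
  exact Finset.sum_nonneg fun j _ => softplus_sub_nonneg x j _

/-- The loss is coercive if all weights are positive. -/
theorem norm_le_wLoss {q : Config J → ℝ} {c₀ : ℝ} (hc₀ : 0 < c₀) (hq : ∀ x, c₀ ≤ q x)
    {M : Matrix (Fin J) (Fin J) ℝ} (hM : M.IsSymm) : ‖M‖ ≤ 2 * (wLoss q M / c₀) := by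
  have hterm : ∀ x : Config J, ∀ j,
      0 ≤ softplus (ip (design j x) M) - toVec x j * ip (design j x) M :=
    fun x j => softplus_sub_nonneg x j _
  have hq0 : ∀ x, 0 ≤ q x := fun x => hc₀.le.trans (hq x)
  have hnn : ∀ x : Config J, 0 ≤ q x * ∑ j, (softplus (ip (design j x) M) -
      toVec x j * ip (design j x) M) := fun x =>
    mul_nonneg (hq0 x) (Finset.sum_nonneg fun j _ => hterm x j)
  refine norm_le_of_abs_ip_design_le hM
    (div_nonneg (Finset.sum_nonneg fun x _ => hnn x) hc₀.le) fun j x => ?_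
  rw [le_div_iff₀ hc₀]
  have hone : ∀ y : Config J, c₀ * (softplus (ip (design j y) M) -
      toVec y j * ip (design j y) M) ≤ q y * ∑ j, (softplus (ip (design j y) M) -
      toVec y j * ip (design j y) M) := fun y =>
    mul_le_mul (hq y) (Finset.single_le_sum (f := fun j => softplus (ip (design j y) M) -
      toVec y j * ip (design j y) M) (fun j _ => hterm y j) (Finset.mem_univ j)) (hterm y j) (hq0 y)
  -- Keep only `x` and its flip: same predictor `t`, opposite responses, so their losses add up to
  -- `2 softplus t - t ≥ |t|`.
  have hpair : ∑ y ∈ ({x, flipAt j x} : Finset (Config J)), q y * ∑ j, (softplus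
      (ip (design j y) M) - toVec y j * ip (design j y) M) ≤ wLoss q M :=
    Finset.sum_le_sum_of_subset_of_nonneg (Finset.subset_univ _) fun y _ _ => hnn y
  rw [Finset.sum_pair (flip_ne j x).symm] at hpair
  have h1 := hone x
  have h2 := hone (flipAt j x)
  have h3 := mul_le_mul_of_nonneg_left (abs_le_softplus (ip (design j x) M)) hc₀.le
  simp only [design_flip, toVec_flip] at h2 h1
  rw [mul_comm]
  refine h3.trans (le_trans (le_of_eq ?_) ((add_le_add h1 h2).trans hpair))
  ring

theorem continuous_wLoss (q : Config J → ℝ) : Continuous (wLoss q) := by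
  unfold wLoss
  refine continuous_finsetSum _ fun x _ => continuous_const.mul ?_
  refine continuous_finsetSum _ fun j _ => ?_
  have h : Continuous fun M : Matrix (Fin J) (Fin J) ℝ => ip (design j x) M :=
    LinearMap.continuous_of_finiteDimensional (ip (design j x))
  exact (continuous_softplus.comp h).sub (continuous_const.mul h)

/-- First order expansion of the gradient around the true parameter. -/
theorem exists_norm_wGrad_add_le (M₀ : Matrix (Fin J) (Fin J) ℝ) :
    ∃ C : ℝ, 0 ≤ C ∧ ∀ (q : Config J → ℝ) (M Δ : Matrix (Fin J) (Fin J) ℝ) (γ : ℝ),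
      ‖wGrad q M + γ • infoApply M₀ Δ‖ ≤
        C * ((∑ x, |q x - pmf M₀ x|) + ‖M - M₀‖ ^ 2 + ‖M - M₀ + γ • Δ‖) := by
  set a : ℝ := 1 + ((J : ℝ) ^ 2) ^ 2 with ha
  have ha0 : 0 ≤ a := by positivity
  have ha1 : 1 ≤ a := by rw [ha]; linarith [sq_nonneg ((J : ℝ) ^ 2)]
  refine ⟨∑ _x : Config J, ∑ _j : Fin J, a, by positivity, fun q M Δ γ => ?_⟩
  set R : ℝ := (∑ x, |q x - pmf M₀ x|) + ‖M - M₀‖ ^ 2 + ‖M - M₀ + γ • Δ‖ with hR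
  -- After subtracting the vanishing score at the truth, three terms remain: sampling error, Taylor
  -- remainder, and the information applied to `M - M₀ + γ Δ`.
  have e : wGrad q M + γ • infoApply M₀ Δ = ∑ x, ∑ j,
      ((q x - pmf M₀ x) * (Real.sigmoid (ip (design j x) M) - toVec x j) +
        pmf M₀ x * (Real.sigmoid (ip (design j x) M) - Real.sigmoid (ip (design j x) M₀) -
          Real.sigmoid (ip (design j x) M₀) * (1 - Real.sigmoid (ip (design j x) M₀)) *
            (ip (design j x) M - ip (design j x) M₀)) +
        pmf M₀ x * (Real.sigmoid (ip (design j x) M₀) *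
          (1 - Real.sigmoid (ip (design j x) M₀))) * ip (design j x) (M - M₀ + γ • Δ)) •
        design j x := by
    rw [← sub_zero (wGrad q M), ← wGrad_pmf M₀, infoApply_eq, wGrad, wGrad]
    simp only [Finset.smul_sum, ← Finset.sum_sub_distrib, ← Finset.sum_add_distrib, smul_smul,
      ← sub_smul, ← add_smul]
    refine Finset.sum_congr rfl fun x _ => Finset.sum_congr rfl fun j _ => ?_
    congr 1
    rw [map_add, map_sub, map_smul, smul_eq_mul]
    ring
  rw [e, Finset.sum_mul]
  refine (norm_sum_le _ _).trans (Finset.sum_le_sum fun x _ => ?_)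
  rw [Finset.sum_mul]
  refine (norm_sum_le _ _).trans (Finset.sum_le_sum fun j _ => ?_)
  rw [norm_smul, Real.norm_eq_abs]
  refine (mul_le_of_le_one_right (abs_nonneg _) (abs_design_le j x)).trans ?_
  have hp0 := (pmf_pos M₀ x).le
  have hp1 := pmf_le_one M₀ x
  refine (abs_add_le _ _).trans ?_
  rw [hR, mul_add, mul_add]
  refine add_le_add ((abs_add_le _ _).trans (add_le_add ?_ ?_)) ?_
  · rw [abs_mul]
    calc _ ≤ |q x - pmf M₀ x| * 1 :=
          mul_le_mul_of_nonneg_left (abs_sigmoid_sub_toVec_le x j _) (abs_nonneg _)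
      _ ≤ ∑ x, |q x - pmf M₀ x| := by
          rw [mul_one]
          exact Finset.single_le_sum (f := fun x => |q x - pmf M₀ x|)
            (fun x _ => abs_nonneg _) (Finset.mem_univ x)
      _ ≤ _ := le_mul_of_one_le_left (Finset.sum_nonneg fun x _ => abs_nonneg _) ha1
  · rw [abs_mul, abs_of_nonneg hp0]
    calc _ ≤ 1 * (ip (design j x) M - ip (design j x) M₀) ^ 2 :=
          mul_le_mul hp1 (abs_sigmoid_remainder_le _ _) (abs_nonneg _) zero_le_one
      _ = |ip (design j x) (M - M₀)| ^ 2 := by rw [map_sub, sq_abs, one_mul]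
      _ ≤ ((J : ℝ) ^ 2 * ‖M - M₀‖) ^ 2 := by gcongr; exact abs_ip_design_le j x _
      _ = ((J : ℝ) ^ 2) ^ 2 * ‖M - M₀‖ ^ 2 := mul_pow _ _ _
      _ ≤ _ := by gcongr; rw [ha]; linarith
  · rw [abs_mul, abs_of_nonneg (mul_nonneg hp0 (sigmoid_mul_nonneg _))]
    calc _ ≤ 1 * ((J : ℝ) ^ 2 * ‖M - M₀ + γ • Δ‖) :=
          mul_le_mul (mul_le_one₀ hp1 (sigmoid_mul_nonneg _) (sigmoid_mul_le_one _))
            (abs_ip_design_le j x _) (abs_nonneg _) zero_le_one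
      _ ≤ _ := by
          rw [one_mul]
          gcongr
          rw [ha]
          nlinarith [sq_nonneg ((J : ℝ) ^ 2 - 1)]

end Estimates

/-! ### From the irrepresentable condition to a dual certificate -/

section Certificate

variable {J K : ℕ}

/-! ### Orthogonal projections and the norms of the irrepresentable condition -/

theorem proj_add_projPerp (W : Submodule ℝ (Matrix (Fin J) (Fin J) ℝ))
    (A : Matrix (Fin J) (Fin J) ℝ) : proj W A + projPerp W A = A := by
  rw [proj, projPerp, ← map_add, Submodule.starProjection_add_starProjection_orthogonal,
    LinearEquiv.symm_apply_apply]

theorem inner_vecEquiv (A B : Matrix (Fin J) (Fin J) ℝ) :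
    inner ℝ (vecEquiv J A) (vecEquiv J B) = ip A B := by
  rw [ip_comm, ip_eq_dotProduct]
  rfl

theorem ip_projPerp_eq_zero {W : Submodule ℝ (Matrix (Fin J) (Fin J) ℝ)}
    {V : Matrix (Fin J) (Fin J) ℝ} (hV : V ∈ W) (A : Matrix (Fin J) (Fin J) ℝ) :
    ip (projPerp W A) V = 0 := by
  rw [ip_comm, ← inner_vecEquiv, projPerp, LinearEquiv.apply_symm_apply]
  exact Submodule.inner_right_of_mem_orthogonal (Submodule.mem_map_of_mem hV)
    (Submodule.starProjection_apply_mem _ _)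

theorem abs_entry_le_maxNorm (A : Matrix (Fin J) (Fin J) ℝ) (i j : Fin J) :
    |A i j| ≤ maxNorm A :=
  le_ciSup (f := fun p : Fin J × Fin J => |A p.1 p.2|) (Set.finite_range _).bddAbove (i, j)

theorem maxNorm_le_norm (A : Matrix (Fin J) (Fin J) ℝ) : maxNorm A ≤ ‖A‖ :=
  Real.iSup_le (fun p => abs_entry_le A p.1 p.2) (norm_nonneg _)

theorem dotProduct_mulVec_le_spectralNorm (A : Matrix (Fin J) (Fin J) ℝ) (v : Fin J → ℝ) :
    v ⬝ᵥ A.mulVec v ≤ spectralNorm A * (v ⬝ᵥ v) := by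
  have h := Matrix.inner_toEuclideanCLM A (WithLp.toLp 2 v) (WithLp.toLp 2 v)
  have hv : v ⬝ᵥ v = ‖WithLp.toLp 2 v‖ ^ 2 := by
    rw [← real_inner_self_eq_norm_sq, EuclideanSpace.inner_toLp_toLp]
    simp
  calc v ⬝ᵥ A.mulVec v = inner ℝ (WithLp.toLp 2 v)
        (Matrix.toEuclideanCLM (𝕜 := ℝ) A (WithLp.toLp 2 v)) := h.symm
    _ ≤ ‖WithLp.toLp 2 v‖ * ‖Matrix.toEuclideanCLM (𝕜 := ℝ) A (WithLp.toLp 2 v)‖ :=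
        real_inner_le_norm _ _
    _ ≤ ‖WithLp.toLp 2 v‖ * (spectralNorm A * ‖WithLp.toLp 2 v‖) := by
        gcongr; exact ContinuousLinearMap.le_opNorm _ _
    _ = spectralNorm A * (v ⬝ᵥ v) := by rw [hv]; ring

/-! ### The projection onto the orthogonal complement of the column space -/

/-- The orthogonal projection `1 - U Uᵀ` onto the complement of the column space of `U`. -/
def coProj (U : Matrix (Fin J) (Fin K) ℝ) : Matrix (Fin J) (Fin J) ℝ := 1 - U * U.transpose

theorem coProj_isSymm (U : Matrix (Fin J) (Fin K) ℝ) : (coProj U).IsSymm := by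
  simp [Matrix.IsSymm, coProj]

theorem transpose_coProj (U : Matrix (Fin J) (Fin K) ℝ) : (coProj U).transpose = coProj U :=
  coProj_isSymm U

theorem coProj_mul {U : Matrix (Fin J) (Fin K) ℝ} (hU : U.transpose * U = 1) :
    coProj U * U = 0 := by
  rw [coProj, Matrix.sub_mul, Matrix.one_mul, Matrix.mul_assoc, hU, Matrix.mul_one, sub_self]

theorem coProj_mul_self {U : Matrix (Fin J) (Fin K) ℝ} (hU : U.transpose * U = 1) :
    coProj U * coProj U = coProj U := by
  nth_rw 2 [coProj]
  rw [Matrix.mul_sub, ← Matrix.mul_assoc, coProj_mul hU, Matrix.zero_mul, sub_zero, Matrix.mul_one]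

theorem coProj_posSemidef {U : Matrix (Fin J) (Fin K) ℝ} (hU : U.transpose * U = 1) :
    (coProj U).PosSemidef := by
  have h := Matrix.posSemidef_conjTranspose_mul_self (coProj U)
  rwa [Matrix.conjTranspose_eq_transpose_of_trivial, transpose_coProj, coProj_mul_self hU] at h

/-- A symmetric matrix minus its compression to the complement of the column space of `U` is
tangent. -/
theorem sub_compression_mem_tangentSpace (U : Matrix (Fin J) (Fin K) ℝ)
    {A : Matrix (Fin J) (Fin J) ℝ} (hA : A.IsSymm) :
    A - coProj U * A * coProj U ∈ tangentSpace U := by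
  -- With `P = U Uᵀ`, `A - (1-P) A (1-P) = P A + A P - P A P`; the half shares `P A P` between the
  -- two transposed terms.
  refine ⟨U.transpose * A - (1 / 2 : ℝ) • (U.transpose * A * U * U.transpose), ?_⟩
  have e : U.transpose * A * U * U.transpose = U.transpose * (A * (U * U.transpose)) := by
    simp only [Matrix.mul_assoc]
  rw [e]
  simp only [coProj, Matrix.transpose_sub, Matrix.transpose_smul, Matrix.transpose_mul,
    Matrix.transpose_transpose, hA.eq, Matrix.mul_sub, Matrix.sub_mul, Matrix.one_mul,
    Matrix.mul_one, Matrix.mul_smul, Matrix.smul_mul, Matrix.mul_assoc]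
  module

theorem ip_coProj {U : Matrix (Fin J) (Fin K) ℝ} (hU : U.transpose * U = 1)
    (A : Matrix (Fin J) (Fin J) ℝ) :
    ip (coProj U) A = (coProj U * A * coProj U).trace := by
  rw [ip_eq_trace, transpose_coProj, Matrix.trace_mul_comm (coProj U * A), ← Matrix.mul_assoc,
    coProj_mul_self hU]

/-- Testing against the tangent vector with `Y = (R U)ᵀ` produces the squared Frobenius norm of `R
U`. -/
theorem mul_eq_zero_of_ip_tangentSpace_eq_zero {U : Matrix (Fin J) (Fin K) ℝ}
    {R : Matrix (Fin J) (Fin J) ℝ} (hR : R.IsSymm) (h : ∀ V ∈ tangentSpace U, ip R V = 0) :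
    R * U = 0 := by
  have hsym : ∀ A, ip R A.transpose = ip R A := fun A => by rw [← ip_transpose, hR.eq]
  have key : ∀ Y : Matrix (Fin K) (Fin J) ℝ, ip R (U * Y) = 0 := by
    intro Y
    have h1 := h _ ⟨Y, rfl⟩
    rw [← Matrix.transpose_mul, map_add, hsym] at h1
    linarith
  have h1 := key (R * U).transpose
  rw [ip_eq_trace, hR.eq, ← Matrix.mul_assoc] at h1
  have := Matrix.trace_mul_conjTranspose_self_eq_zero_iff (A := R * U)
  rw [Matrix.conjTranspose_eq_transpose_of_trivial] at this
  exact this.1 h1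

/-! ### The dual certificate -/

/-- A strictly feasible dual certificate for the regularised problem: the direction
`I(S + L)` with `S` sparse and `L` tangent that the irrepresentable condition provides. -/
structure IsCertificate (S₀ : Matrix (Fin J) (Fin J) ℝ) (U : Matrix (Fin J) (Fin K) ℝ) (ρ κ : ℝ)
    (W : Matrix (Fin J) (Fin J) ℝ) : Prop where
  pos : 0 < κ
  symm : W.IsSymm
  diag : ∀ i, W i i = 0
  sign : ∀ i j, i ≠ j → S₀ i j ≠ 0 → W i j = Real.sign (S₀ i j)
  off_support : ∀ i j, i ≠ j → S₀ i j = 0 → |W i j| ≤ 1 - κ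
  mul_eq : W * U = ρ • U
  -- Only an upper bound on the form of `W` is kept, by `ρ - κ` off the columns of `U`: it will be
  -- paired with positive semidefinite matrices.
  posSemidef : (ρ • (1 : Matrix (Fin J) (Fin J) ℝ) - W - κ • coProj U).PosSemidef

theorem signOffDiag_isSymm {S₀ : Matrix (Fin J) (Fin J) ℝ} (hS : S₀.IsSymm) :
    (signOffDiag S₀).IsSymm := by
  ext i j
  simp only [signOffDiag, Matrix.transpose_apply, Matrix.of_apply, eq_comm (a := j), hS.apply i j]

theorem entry_eq_zero_of_ip_sparseSpace_eq_zero {S₀ R : Matrix (Fin J) (Fin J) ℝ}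
    (hS : S₀.IsSymm) (hR : R.IsSymm) (h : ∀ V ∈ sparseSpace S₀, ip R V = 0) {i j : Fin J}
    (hij : i = j ∨ S₀ i j ≠ 0) : R i j = 0 := by
  have hmem : Matrix.single i j (1 : ℝ) + Matrix.single j i 1 ∈ sparseSpace S₀ := by
    refine ⟨by simp [Matrix.IsSymm, add_comm], fun a b hab h0 => ?_⟩
    have hne : ¬ (i = a ∧ j = b) ∧ ¬ (j = a ∧ i = b) := by
      refine ⟨?_, ?_⟩
      · rintro ⟨rfl, rfl⟩; exact hij.elim hab fun h => h h0
      · rintro ⟨rfl, rfl⟩; exact hij.elim (fun h => hab h.symm) fun h => h (by rw [hS.apply]; exact h0)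
    rw [Matrix.add_apply, Matrix.single_apply, Matrix.single_apply, if_neg hne.1, if_neg hne.2,
      add_zero]
  have h1 := h _ hmem
  rw [map_add, ip_single, ip_single, hR.apply i j] at h1
  linarith

/-- `F` prescribes the components of `W` along the two spaces, and `F^⊥` gives the remainders `R₁`,
`R₂`. Orthogonality makes `R₁` vanish on the diagonal and the support and makes `R₂` kill `U`; the
strict norm bound leaves the slack `κ`. -/
theorem exists_certificate {M S₀ : Matrix (Fin J) (Fin J) ℝ} {U : Matrix (Fin J) (Fin K) ℝ}
    {ρ : ℝ} (hS : S₀.IsSymm) (hU : U.transpose * U = 1) (hρ : 0 < ρ)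
    (h : Irrepresentable M S₀ U ρ) :
    ∃ A ∈ sparseSpace S₀, ∃ B ∈ tangentSpace U, ∃ κ : ℝ,
      IsCertificate S₀ U ρ κ (infoApply M (A + B)) := by
  obtain ⟨⟨⟨A, hA⟩, ⟨B, hB⟩⟩, hF, hlt⟩ := h
  set W := infoApply M (A + B) with hWdef
  have hWs : W.IsSymm := infoApply_isSymm M _
  rw [opF, Prod.mk.injEq] at hF
  obtain ⟨hF1, hF2⟩ := hF
  change proj (sparseSpace S₀) W = _ at hF1
  change proj (tangentSpace U) W = _ at hF2
  change max (maxNorm (projPerp (sparseSpace S₀) W)) (spectralNorm (projPerp (tangentSpace U) W) / ρ)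
    < 1 at hlt
  obtain ⟨hlt1, hlt2⟩ := max_lt_iff.1 hlt
  have hW1 := proj_add_projPerp (sparseSpace S₀) W
  have hW2 := proj_add_projPerp (tangentSpace U) W
  have hp1 : ∀ V ∈ sparseSpace S₀, ip (projPerp (sparseSpace S₀) W) V = 0 :=
    fun V hV => ip_projPerp_eq_zero hV W
  have hp2 : ∀ V ∈ tangentSpace U, ip (projPerp (tangentSpace U) W) V = 0 :=
    fun V hV => ip_projPerp_eq_zero hV W
  rw [hF1] at hW1
  rw [hF2] at hW2
  generalize projPerp (sparseSpace S₀) W = R₁ at *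
  generalize projPerp (tangentSpace U) W = R₂ at *
  have hR₁ : R₁.IsSymm := by
    rw [← eq_sub_iff_add_eq'] at hW1
    rw [hW1]; exact hWs.sub (signOffDiag_isSymm hS)
  have hR₂ : R₂.IsSymm := by
    rw [← eq_sub_iff_add_eq'] at hW2
    rw [hW2]; exact hWs.sub (Matrix.IsSymm.smul (by simp [Matrix.IsSymm]) ρ)
  have hRU := mul_eq_zero_of_ip_tangentSpace_eq_zero hR₂ hp2
  rw [div_lt_one hρ] at hlt2
  set κ : ℝ := min (1 - maxNorm R₁) (ρ - spectralNorm R₂) with hκ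
  refine ⟨A, hA, B, hB, κ, ?_⟩
  rw [← hWdef]
  refine ⟨lt_min (by linarith) (by linarith), hWs, fun i => ?_, fun i j hij h0 => ?_,
    fun i j hij h0 => ?_, ?_, ?_⟩
  · rw [← hW1, Matrix.add_apply, entry_eq_zero_of_ip_sparseSpace_eq_zero hS hR₁ hp1 (Or.inl rfl)]
    simp [signOffDiag]
  · rw [← hW1, Matrix.add_apply, entry_eq_zero_of_ip_sparseSpace_eq_zero hS hR₁ hp1 (Or.inr h0)]
    simp [signOffDiag, hij]
  · rw [← hW1, Matrix.add_apply]
    have : signOffDiag S₀ i j = 0 := by simp [signOffDiag, h0]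
    rw [this, zero_add]
    have h1 := abs_entry_le_maxNorm R₁ i j
    have h2 : κ ≤ 1 - maxNorm R₁ := min_le_left _ _
    linarith
  · rw [← hW2, Matrix.add_mul, hRU, add_zero, Matrix.smul_mul, Matrix.mul_assoc, hU, Matrix.mul_one]
  · have hRQ : R₂ * coProj U = R₂ := by
      rw [coProj, Matrix.mul_sub, ← Matrix.mul_assoc, hRU, Matrix.zero_mul, sub_zero, Matrix.mul_one]
    have hQR : coProj U * R₂ = R₂ := by
      have := congrArg Matrix.transpose hRQ
      rwa [Matrix.transpose_mul, hR₂.eq, transpose_coProj] at this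
    -- Since `R₂` is its own compression by `coProj U`, the slack matrix is the compression of `(ρ -
    -- κ) 1 - R₂`, which the spectral norm bound makes positive semidefinite.
    have e : ρ • (1 : Matrix (Fin J) (Fin J) ℝ) - W - κ • coProj U =
        (coProj U).conjTranspose * ((ρ - κ) • (1 : Matrix (Fin J) (Fin J) ℝ) - R₂) * coProj U := by
      rw [Matrix.conjTranspose_eq_transpose_of_trivial, transpose_coProj, Matrix.mul_sub,
        Matrix.sub_mul, hQR, hRQ, Matrix.mul_smul, Matrix.smul_mul, Matrix.mul_one,
        coProj_mul_self hU, ← hW2, coProj]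
      module
    rw [e]
    refine Matrix.PosSemidef.conjTranspose_mul_mul_same ?_ _
    refine Matrix.PosSemidef.of_dotProduct_mulVec_nonneg ?_ fun v => ?_
    · rw [Matrix.IsHermitian, Matrix.conjTranspose_eq_transpose_of_trivial]
      exact (Matrix.isSymm_one.smul _).sub hR₂
    · rw [star_trivial, Matrix.sub_mulVec, dotProduct_sub, Matrix.smul_mulVec, Matrix.one_mulVec,
        dotProduct_smul, smul_eq_mul]
      have h1 := dotProduct_mulVec_le_spectralNorm R₂ v
      have h2 : κ ≤ ρ - spectralNorm R₂ := min_le_right _ _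
      have h3 : 0 ≤ v ⬝ᵥ v := Finset.sum_nonneg fun i _ => mul_self_nonneg _
      nlinarith

end Certificate

/-! ### Optimality conditions and what the certificate says about solutions -/

section FirstOrder

variable {J K : ℕ}

/-! ### The weighted problem and its first order conditions -/

/-- The objective for a weighted sample, with the trace in place of the nuclear norm. -/
def wObjective (q : Config J → ℝ) (γ δ : ℝ) (L S : Matrix (Fin J) (Fin J) ℝ) : ℝ :=
  wLoss q (L + S) + γ * offDiagL1 S + δ * L.trace

/-- The pair `(L, S)` solves the regularised problem for a weighted sample. -/
structure IsSolution (q : Config J → ℝ) (γ δ : ℝ) (L S : Matrix (Fin J) (Fin J) ℝ) : Prop where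
  posSemidef : L.PosSemidef
  isSymm : S.IsSymm
  le : ∀ L' S' : Matrix (Fin J) (Fin J) ℝ, L'.PosSemidef → S'.IsSymm →
    wObjective q γ δ L S ≤ wObjective q γ δ L' S'

theorem isSymm_of_posSemidef {A : Matrix (Fin J) (Fin J) ℝ} (hA : A.PosSemidef) : A.IsSymm := by
  have := hA.isHermitian
  rwa [Matrix.IsHermitian, Matrix.conjTranspose_eq_transpose_of_trivial] at this

theorem objective_eq {N : ℕ} (γ δ : ℝ) (x : Fin N → Config J) {L : Matrix (Fin J) (Fin J) ℝ}
    (hL : L.PosSemidef) (S : Matrix (Fin J) (Fin J) ℝ) :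
    objective γ δ x L S = wObjective (empFreq x) γ δ L S := by
  rw [objective, wObjective, negLogPL_eq, nuclearNorm_eq_trace hL]

theorem mem_solutions_iff {N : ℕ} {γ δ : ℝ} {x : Fin N → Config J}
    {p : Matrix (Fin J) (Fin J) ℝ × Matrix (Fin J) (Fin J) ℝ} :
    p ∈ solutions γ δ x ↔ IsSolution (empFreq x) γ δ p.1 p.2 := by
  constructor
  · rintro ⟨h1, h2, h3⟩
    refine ⟨h1, h2, fun L S hL hS => ?_⟩
    rw [← objective_eq γ δ x h1, ← objective_eq γ δ x hL]
    exact h3 L S hL hS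
  · rintro ⟨h1, h2, h3⟩
    refine ⟨h1, h2, fun L S hL hS => ?_⟩
    rw [objective_eq γ δ x h1, objective_eq γ δ x hL]
    exact h3 L S hL hS

theorem offDiagL1_nonneg (S : Matrix (Fin J) (Fin J) ℝ) : 0 ≤ offDiagL1 S :=
  Finset.sum_nonneg fun i _ => Finset.sum_nonneg fun j _ => by split_ifs <;> positivity

theorem continuous_offDiagL1 :
    Continuous (offDiagL1 : Matrix (Fin J) (Fin J) ℝ → ℝ) := by
  unfold offDiagL1
  refine continuous_finsetSum _ fun i _ => continuous_finsetSum _ fun j _ => ?_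
  split_ifs
  · exact continuous_const
  · exact (continuous_id.matrix_elem i j).abs

theorem offDiagL1_convex {t : ℝ} (h0 : 0 ≤ t) (h1 : t ≤ 1) (S S' : Matrix (Fin J) (Fin J) ℝ) :
    offDiagL1 (S + t • (S' - S)) ≤ offDiagL1 S + t * (offDiagL1 S' - offDiagL1 S) := by
  have e : offDiagL1 S + t * (offDiagL1 S' - offDiagL1 S) = ∑ i, ∑ j,
      ((1 - t) * (if i = j then 0 else |S i j|) + t * (if i = j then 0 else |S' i j|)) := by
    simp only [Finset.sum_add_distrib, ← Finset.mul_sum, offDiagL1]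
    ring
  rw [e, offDiagL1]
  refine Finset.sum_le_sum fun i _ => Finset.sum_le_sum fun j _ => ?_
  split_ifs
  · simp
  · have : (S + t • (S' - S)) i j = (1 - t) * S i j + t * S' i j := by
      simp only [Matrix.add_apply, Matrix.smul_apply, Matrix.sub_apply, smul_eq_mul]; ring
    rw [this]
    refine (abs_add_le _ _).trans ?_
    rw [abs_mul, abs_mul, abs_of_nonneg h0, abs_of_nonneg (sub_nonneg.2 h1)]

theorem deriv_nonneg_of_min_right {f : ℝ → ℝ} {f' : ℝ} (hf : HasDerivAt f f' 0)
    (h : ∀ t, 0 < t → t ≤ 1 → f 0 ≤ f t) : 0 ≤ f' := by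
  have h1 := hf.tendsto_slope_zero_right
  refine ge_of_tendsto h1 ?_
  filter_upwards [Ioc_mem_nhdsGT (zero_lt_one (α := ℝ))] with t ht
  rw [zero_add, smul_eq_mul]
  exact mul_nonneg (inv_nonneg.2 ht.1.le) (sub_nonneg.2 (h t ht.1 ht.2))

/-- The variational inequality satisfied by a solution. -/
theorem IsSolution.variational {q : Config J → ℝ} {γ δ : ℝ} {L S : Matrix (Fin J) (Fin J) ℝ}
    (h : IsSolution q γ δ L S) (hγ : 0 ≤ γ) {L' S' : Matrix (Fin J) (Fin J) ℝ}
    (hL' : L'.PosSemidef) (hS' : S'.IsSymm) :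
    0 ≤ ip (wGrad q (L + S)) (L' + S' - (L + S)) + γ * (offDiagL1 S' - offDiagL1 S) +
      δ * (L'.trace - L.trace) := by
  set V := L' + S' - (L + S) with hV
  set c := γ * (offDiagL1 S' - offDiagL1 S) + δ * (L'.trace - L.trace) with hc
  -- Only the loss is differentiated. The penalties are replaced by their chords along the segment,
  -- which majorize the objective and agree with it at `t = 0`.
  have hd : HasDerivAt (fun t : ℝ => wLoss q (L + S + t • V) + t * c)
      (ip (wGrad q (L + S)) V + c) 0 := by
    have h1 := hasDerivAt_wLoss q (L + S) V 0
    rw [zero_smul, add_zero] at h1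
    simpa using h1.fun_add ((hasDerivAt_id (0 : ℝ)).mul_const c)
  have := deriv_nonneg_of_min_right hd fun t ht0 ht1 => ?_
  · rw [hc] at this; linarith
  · have hLt : (L + t • (L' - L)).PosSemidef := by
      have : L + t • (L' - L) = (1 - t) • L + t • L' := by module
      rw [this]
      exact (h.posSemidef.smul (sub_nonneg.2 ht1)).add (hL'.smul ht0.le)
    have hSt : (S + t • (S' - S)).IsSymm := h.isSymm.add ((hS'.sub h.isSymm).smul t)
    have hmin := h.le _ _ hLt hSt
    rw [wObjective, wObjective] at hmin
    have e : L + t • (L' - L) + (S + t • (S' - S)) = L + S + t • V := by rw [hV]; module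
    rw [e] at hmin
    have htr : (L + t • (L' - L)).trace = L.trace + t * (L'.trace - L.trace) := by
      simp [Matrix.trace_add, Matrix.trace_smul, Matrix.trace_sub]
    rw [htr] at hmin
    have hconv := mul_le_mul_of_nonneg_left (offDiagL1_convex ht0.le ht1 S S') hγ
    simp only [zero_smul, add_zero, zero_mul]
    rw [hc]
    nlinarith [hmin, hconv]

/-! ### Consequences of the certificate -/

variable {S₀ W : Matrix (Fin J) (Fin J) ℝ} {U : Matrix (Fin J) (Fin K) ℝ} {ρ κ : ℝ}

theorem IsCertificate.entry_abs_le (hW : IsCertificate S₀ U ρ κ W) (i j : Fin J) (hij : i ≠ j) :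
    |W i j| ≤ 1 := by
  by_cases h : S₀ i j = 0
  · have := hW.off_support i j hij h
    have := hW.pos
    linarith
  · rw [hW.sign i j hij h]
    rcases Real.sign_apply_eq (S₀ i j) with h | h | h <;> rw [h] <;> norm_num

/-- The certificate is a subgradient of the `ℓ₁` penalty. -/
theorem IsCertificate.ip_le_offDiagL1 (hW : IsCertificate S₀ U ρ κ W)
    (S : Matrix (Fin J) (Fin J) ℝ) : ip W S ≤ offDiagL1 S := by
  rw [ip_apply, offDiagL1]
  refine Finset.sum_le_sum fun i _ => Finset.sum_le_sum fun j _ => ?_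
  split_ifs with hij
  · rw [hij, hW.diag, zero_mul]
  · refine (le_abs_self _).trans ?_
    rw [abs_mul]
    exact mul_le_of_le_one_left (abs_nonneg _) (hW.entry_abs_le i j hij)

theorem sign_mul_self_eq_abs (r : ℝ) : Real.sign r * r = |r| := by
  rcases lt_trichotomy r 0 with h | h | h
  · rw [Real.sign_of_neg h, abs_of_neg h]; ring
  · simp [h]
  · rw [Real.sign_of_pos h, abs_of_pos h]; ring

theorem IsCertificate.ip_eq_offDiagL1 (hW : IsCertificate S₀ U ρ κ W)
    {S : Matrix (Fin J) (Fin J) ℝ}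
    (hS : ∀ i j, i ≠ j → Real.sign (S i j) = Real.sign (S₀ i j)) : ip W S = offDiagL1 S := by
  rw [ip_apply, offDiagL1]
  refine Finset.sum_congr rfl fun i _ => Finset.sum_congr rfl fun j _ => ?_
  split_ifs with hij
  · rw [hij, hW.diag, zero_mul]
  · by_cases h : S₀ i j = 0
    · have h0 := hS i j hij
      rw [h, Real.sign_zero, Real.sign_eq_zero_iff] at h0
      rw [h0, mul_zero, abs_zero]
    · rw [hW.sign i j hij h, ← hS i j hij]
      exact sign_mul_self_eq_abs _

/-- Pairing the semidefinite slack with `L` shows that mass of `L` off the columns of `U` costs at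
rate `κ`. -/
theorem IsCertificate.ip_coProj_le (hW : IsCertificate S₀ U ρ κ W)
    {L : Matrix (Fin J) (Fin J) ℝ} (hL : L.PosSemidef) :
    κ * ip (coProj U) L ≤ ρ * L.trace - ip W L := by
  have h := ip_nonneg_of_posSemidef hW.posSemidef hL
  simp only [map_sub, map_smul, LinearMap.sub_apply, LinearMap.smul_apply, smul_eq_mul,
    ip_one_left] at h
  linarith

/-- `W` acts as `ρ` on the columns of `U`, so it matches the trace penalty exactly along tangent
directions. At the reference point only a second order excess is therefore left. -/
theorem IsCertificate.ip_tangent (hW : IsCertificate S₀ U ρ κ W) {B : Matrix (Fin J) (Fin J) ℝ}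
    (hB : B ∈ tangentSpace U) : ip W B = ρ * B.trace := by
  obtain ⟨Y, rfl⟩ := hB
  have h1 : ip W (U * Y) = ρ * (U * Y).trace := by
    rw [ip_eq_trace, hW.symm.eq, ← Matrix.mul_assoc, hW.mul_eq, Matrix.smul_mul,
      Matrix.trace_smul, smul_eq_mul]
  have h2 : ip W (Y.transpose * U.transpose) = ρ * (Y.transpose * U.transpose).trace := by
    rw [← Matrix.transpose_mul, ← ip_transpose, hW.symm.eq, h1, Matrix.trace_transpose]
  rw [map_add, h1, h2, Matrix.trace_add, mul_add]

/-- The basic inequality: comparison of a solution with a reference point on which the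
certificate is tight for the `ℓ₁` penalty. -/
theorem IsSolution.basic_inequality (hW : IsCertificate S₀ U ρ κ W) {q : Config J → ℝ} {γ : ℝ}
    (hγ : 0 ≤ γ) {L S L₁ S₁ : Matrix (Fin J) (Fin J) ℝ} (h : IsSolution q γ (ρ * γ) L S)
    (hL₁ : L₁.PosSemidef) (hS₁ : S₁.IsSymm) (htight : ip W S₁ = offDiagL1 S₁) :
    ip (wGrad q (L + S) - wGrad q (L₁ + S₁)) (L + S - (L₁ + S₁)) + γ * (κ * ip (coProj U) L) ≤
      -ip (wGrad q (L₁ + S₁) + γ • W) (L + S - (L₁ + S₁)) +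
        γ * (ρ * L₁.trace - ip W L₁) := by
  have h1 := h.variational hγ hL₁ hS₁
  have h2 := mul_le_mul_of_nonneg_left (hW.ip_le_offDiagL1 S) hγ
  have h3 := mul_le_mul_of_nonneg_left (hW.ip_coProj_le h.posSemidef) hγ
  rw [← neg_sub (L + S) (L₁ + S₁), map_neg, ← htight] at h1
  simp only [map_sub, map_add, map_smul, LinearMap.sub_apply, LinearMap.add_apply,
    LinearMap.smul_apply, smul_eq_mul] at h1 ⊢
  nlinarith [h1, h2, h3]

theorem sum_pair_support {F : Fin J → Fin J → ℝ} {i j : Fin J} (hij : i ≠ j)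
    (hF : ∀ a b, ¬ (a = i ∧ b = j) → ¬ (a = j ∧ b = i) → F a b = 0) :
    ∑ a, ∑ b, F a b = F i j + F j i := by
  rw [Finset.sum_eq_add i j hij, Finset.sum_eq_single j, Finset.sum_eq_single i]
  · intro b _ hb; exact hF j b (fun h => hij h.1.symm) fun h => hb h.2
  · simp
  · intro b _ hb; exact hF i b (fun h => hb h.2) fun h => hij h.1
  · simp
  · intro a _ ha; exact Finset.sum_eq_zero fun b _ => hF a b (fun h => ha.1 h.1) fun h => ha.2 h.1
  · simp
  · simp

/-- Off-diagonal entries at which the gradient is small enough vanish at a solution. -/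
theorem IsSolution.entry_eq_zero {q : Config J → ℝ} {γ δ : ℝ} {L S : Matrix (Fin J) (Fin J) ℝ}
    (h : IsSolution q γ δ L S) (hγ : 0 ≤ γ) {i j : Fin J} (hij : i ≠ j)
    (hg : |wGrad q (L + S) i j| < γ) : S i j = 0 := by
  set g := wGrad q (L + S) with hgdef
  have hgs : g.IsSymm := wGrad_isSymm q _
  -- Deleting the entries `(i,j)` and `(j,i)` saves `2γ |S i j|` of penalty, while the first order
  -- change of the loss is at most `2 |g i j| |S i j|`.
  set E : Matrix (Fin J) (Fin J) ℝ := Matrix.single i j (S i j) + Matrix.single j i (S i j) with hE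
  have hEs : E.IsSymm := by simp [Matrix.IsSymm, hE, add_comm]
  have hji : S j i = S i j := h.isSymm.apply i j
  have hEij : E i j = S i j := by simp [hE, hij]
  have hEji : E j i = S i j := by simp [hE, hij]
  have hE0 : ∀ a b, ¬ (a = i ∧ b = j) → ¬ (a = j ∧ b = i) → E a b = 0 := by
    intro a b h1 h2
    have h1' : ¬ (i = a ∧ j = b) := fun h => h1 ⟨h.1.symm, h.2.symm⟩
    have h2' : ¬ (j = a ∧ i = b) := fun h => h2 ⟨h.1.symm, h.2.symm⟩
    rw [hE, Matrix.add_apply, Matrix.single_apply, Matrix.single_apply, if_neg h1', if_neg h2',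
      add_zero]
  have hv := h.variational hγ h.posSemidef (h.isSymm.sub hEs)
  have e1 : L + (S - E) - (L + S) = -E := by abel
  have e2 : ip g E = 2 * (g i j * S i j) := by
    rw [ip_apply, sum_pair_support hij (fun a b h1 h2 => by rw [hE0 a b h1 h2, mul_zero]), hEij,
      hEji, hgs.apply i j]
    ring
  have e3 : offDiagL1 (S - E) - offDiagL1 S = -(2 * |S i j|) := by
    rw [offDiagL1, offDiagL1, ← Finset.sum_sub_distrib]
    simp only [← Finset.sum_sub_distrib]
    rw [sum_pair_support hij]
    · simp only [Matrix.sub_apply, hEij, hEji, hji, sub_self, abs_zero, if_neg hij,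
        if_neg hij.symm]
      ring
    · intro a b h1 h2
      rw [Matrix.sub_apply, hE0 a b h1 h2, sub_zero, sub_self]
  rw [e1, map_neg, e2, e3, sub_self, mul_zero, add_zero] at hv
  by_contra h0
  have hpos : 0 < |S i j| := abs_pos.2 h0
  have h1 : -(g i j * S i j) ≤ |g i j| * |S i j| := by
    rw [← abs_mul]; exact neg_le_abs _
  nlinarith

/-- If the gradient is close to the certificate, the sparse part of a solution has no spurious
entries. -/
theorem IsSolution.mem_sparseSpace (hW : IsCertificate S₀ U ρ κ W) {q : Config J → ℝ}
    {γ δ ν : ℝ} {L S : Matrix (Fin J) (Fin J) ℝ} (h : IsSolution q γ δ L S) (hγ : 0 < γ)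
    (hν : ν < κ) (hg : ‖wGrad q (L + S) + γ • W‖ ≤ ν * γ) : S ∈ sparseSpace S₀ := by
  refine ⟨h.isSymm, fun i j hij h0 => h.entry_eq_zero hγ.le hij ?_⟩
  have h1 := (abs_entry_le _ i j).trans hg
  rw [Matrix.add_apply, Matrix.smul_apply, smul_eq_mul] at h1
  have h2 := mul_le_mul_of_nonneg_left (hW.off_support i j hij h0) hγ.le
  have e : wGrad q (L + S) i j = (wGrad q (L + S) i j + γ * W i j) - γ * W i j := by ring
  rw [e]
  refine (abs_sub _ _).trans_lt ?_
  rw [abs_mul γ, abs_of_pos hγ]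
  nlinarith

/-- Adding `v vᵀ` to `L` is always admissible, so the loss and the trace penalty together cannot
decrease to first order in that direction. -/
theorem IsSolution.dual_posSemidef {q : Config J → ℝ} {γ δ : ℝ}
    {L S : Matrix (Fin J) (Fin J) ℝ} (h : IsSolution q γ δ L S) (hγ : 0 ≤ γ) :
    (wGrad q (L + S) + δ • (1 : Matrix (Fin J) (Fin J) ℝ)).PosSemidef := by
  refine Matrix.PosSemidef.of_dotProduct_mulVec_nonneg ?_ fun v => ?_
  · rw [Matrix.IsHermitian, Matrix.conjTranspose_eq_transpose_of_trivial]
    exact (wGrad_isSymm q _).add (Matrix.isSymm_one.smul _)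
  · have hvv : (Matrix.vecMulVec v v).PosSemidef := by
      simpa using Matrix.posSemidef_vecMulVec_self_star v
    have hv := h.variational hγ (h.posSemidef.add hvv) h.isSymm
    have e : L + Matrix.vecMulVec v v + S - (L + S) = Matrix.vecMulVec v v := by abel
    rw [e, sub_self, mul_zero, add_zero, Matrix.trace_add, add_sub_cancel_left,
      ← ip_one_left, ← smul_eq_mul, ← LinearMap.smul_apply, ← map_smul, ← LinearMap.add_apply,
      ← map_add, ip_vecMulVec] at hv
    simpa using hv

/-- Complementary slackness. -/
theorem IsSolution.dual_mul_eq_zero {q : Config J → ℝ} {γ δ : ℝ}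
    {L S : Matrix (Fin J) (Fin J) ℝ} (h : IsSolution q γ δ L S) (hγ : 0 ≤ γ) :
    (wGrad q (L + S) + δ • (1 : Matrix (Fin J) (Fin J) ℝ)) * L = 0 := by
  have hp := h.dual_posSemidef hγ
  refine mul_eq_zero_of_ip_eq_zero hp h.posSemidef
    (le_antisymm ?_ (ip_nonneg_of_posSemidef hp h.posSemidef))
  -- Comparison with `L' = 0` gives the reverse inequality for the pairing of the dual variable with
  -- `L`.
  have hv := h.variational hγ Matrix.PosSemidef.zero h.isSymm
  have e : 0 + S - (L + S) = -L := by abel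
  rw [e, map_neg, sub_self, mul_zero, add_zero, Matrix.trace_zero] at hv
  rw [map_add, map_smul, LinearMap.add_apply, LinearMap.smul_apply, ip_one_left, smul_eq_mul]
  linarith

/-- Vectors in the kernel of the dual variable are nearly orthogonal to the complement of the
column space of `U`. -/
theorem IsCertificate.dotProduct_coProj_le (hW : IsCertificate S₀ U ρ κ W)
    {g : Matrix (Fin J) (Fin J) ℝ} {γ ν : ℝ} (hγ : 0 < γ) (hg : ‖g + γ • W‖ ≤ ν * γ)
    {b : Fin J → ℝ} (hb : (g + (ρ * γ) • (1 : Matrix (Fin J) (Fin J) ℝ)).mulVec b = 0) :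
    κ * (b ⬝ᵥ (coProj U).mulVec b) ≤ (J : ℝ) ^ 2 * ν * (b ⬝ᵥ b) := by
  have hbb : (Matrix.vecMulVec b b).PosSemidef := by
    simpa using Matrix.posSemidef_vecMulVec_self_star b
  have h1 := hW.ip_coProj_le hbb
  have htr : (Matrix.vecMulVec b b).trace = b ⬝ᵥ b := by
    rw [← ip_one_left, ip_vecMulVec, Matrix.one_mulVec]
  have h2 := abs_ip_le (g + γ • W) (Matrix.vecMulVec b b)
  have h3 := norm_le_trace hbb
  rw [htr] at h1 h3
  -- On `b` the form of `g` equals `-ργ |b|²`, whereas `g` is close to `-γ W`; hence `b` nearly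
  -- attains the bound `ρ` for `W`, and the gap is at least `κ` times the form of `coProj U`.
  have h0 : ip (g + (ρ * γ) • (1 : Matrix (Fin J) (Fin J) ℝ)) (Matrix.vecMulVec b b) = 0 := by
    rw [ip_vecMulVec, hb, dotProduct_zero]
  rw [map_add, map_smul, LinearMap.add_apply, LinearMap.smul_apply, ip_one_left, htr,
    smul_eq_mul] at h0
  have h4 : ‖g + γ • W‖ * ‖Matrix.vecMulVec b b‖ ≤ ν * γ * (b ⬝ᵥ b) :=
    mul_le_mul hg h3 (norm_nonneg _) ((norm_nonneg _).trans hg)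
  have h5 := (abs_le.1 (h2.trans (mul_le_mul_of_nonneg_left h4 (sq_nonneg (J : ℝ))))).1
  rw [map_add, map_smul, LinearMap.add_apply, LinearMap.smul_apply, smul_eq_mul] at h5
  rw [← ip_vecMulVec]
  refine le_of_mul_le_mul_left ?_ hγ
  nlinarith [mul_le_mul_of_nonneg_left h1 hγ.le]

theorem dotProduct_coProj (hU : U.transpose * U = 1) (b : Fin J → ℝ) :
    b ⬝ᵥ (coProj U).mulVec b = (coProj U).mulVec b ⬝ᵥ (coProj U).mulVec b := by
  rw [Matrix.dotProduct_mulVec ((coProj U).mulVec b), ← Matrix.mulVec_transpose, transpose_coProj,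
    Matrix.mulVec_mulVec, coProj_mul_self hU, dotProduct_comm]

theorem coProj_mulVec_of_transpose_mulVec_eq_zero {b : Fin J → ℝ}
    (hb : U.transpose.mulVec b = 0) : (coProj U).mulVec b = b := by
  rw [coProj, Matrix.sub_mulVec, Matrix.one_mulVec, ← Matrix.mulVec_mulVec, hb,
    Matrix.mulVec_zero, sub_zero]

/-- The hypothesis says that `Uᵀ` is injective on the range of `L`, and it maps into a space of
dimension `K`. -/
theorem rank_le_of_injOn_range {L : Matrix (Fin J) (Fin J) ℝ}
    (h : ∀ w, U.transpose.mulVec (L.mulVec w) = 0 → L.mulVec w = 0) : L.rank ≤ K := by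
  have hker : LinearMap.ker (U.transpose * L).mulVecLin = LinearMap.ker L.mulVecLin := by
    ext w
    simp only [LinearMap.mem_ker, Matrix.mulVecLin_apply, ← Matrix.mulVec_mulVec]
    exact ⟨h w, fun hw => by rw [hw, Matrix.mulVec_zero]⟩
  have h1 := LinearMap.finrank_range_add_finrank_ker (U.transpose * L).mulVecLin
  have h2 := LinearMap.finrank_range_add_finrank_ker L.mulVecLin
  rw [hker] at h1
  have h3 : (U.transpose * L).rank ≤ K := by
    simpa using Matrix.rank_le_card_height (U.transpose * L)
  unfold Matrix.rank at *
  omega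

/-- The range of `L` lies in the kernel of the dual variable. A kernel vector `b` orthogonal to the
columns of `U` is fixed by `coProj U`, so `κ |b|² ≤ J² ν |b|²` and `b = 0`. -/
theorem IsSolution.rank_le (hW : IsCertificate S₀ U ρ κ W) {q : Config J → ℝ} {γ ν : ℝ}
    {L S : Matrix (Fin J) (Fin J) ℝ} (h : IsSolution q γ (ρ * γ) L S) (hγ : 0 < γ)
    (hν : (J : ℝ) ^ 2 * ν < κ) (hg : ‖wGrad q (L + S) + γ • W‖ ≤ ν * γ) : L.rank ≤ K := by
  refine rank_le_of_injOn_range (U := U) fun w hw => ?_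
  have hk : (wGrad q (L + S) + (ρ * γ) • (1 : Matrix (Fin J) (Fin J) ℝ)).mulVec (L.mulVec w) =
      0 := by
    rw [Matrix.mulVec_mulVec, h.dual_mul_eq_zero hγ.le, Matrix.zero_mulVec]
  have h1 := hW.dotProduct_coProj_le hγ hg hk
  rw [coProj_mulVec_of_transpose_mulVec_eq_zero hw] at h1
  have h2 : 0 ≤ L.mulVec w ⬝ᵥ L.mulVec w := Finset.sum_nonneg fun i _ => mul_self_nonneg _
  rw [← dotProduct_self_eq_zero]
  nlinarith

end FirstOrder

/-! ### Existence of solutions, and stability of the low rank plus sparse decomposition -/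

section Stability

variable {J K : ℕ}

/-! ### Existence of solutions -/

theorem wLoss_nonneg {q : Config J → ℝ} (hq : ∀ x, 0 ≤ q x) (M : Matrix (Fin J) (Fin J) ℝ) :
    0 ≤ wLoss q M :=
  Finset.sum_nonneg fun x _ => mul_nonneg (hq x)
    (Finset.sum_nonneg fun j _ => softplus_sub_nonneg x j _)

theorem isClosed_isSymm : IsClosed {A : Matrix (Fin J) (Fin J) ℝ | A.IsSymm} :=
  isClosed_eq continuous_id.matrix_transpose continuous_id

theorem isClosed_posSemidef : IsClosed {A : Matrix (Fin J) (Fin J) ℝ | A.PosSemidef} := by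
  have : {A : Matrix (Fin J) (Fin J) ℝ | A.PosSemidef} =
      {A | A.IsSymm} ∩ ⋂ v : Fin J → ℝ, {A | 0 ≤ v ⬝ᵥ A.mulVec v} := by
    ext A
    simp only [Set.mem_ofPred_eq, Set.mem_inter_iff, Set.mem_iInter]
    exact ⟨fun h => ⟨isSymm_of_posSemidef h, fun v => by simpa using h.dotProduct_mulVec_nonneg v⟩,
      fun h => Matrix.PosSemidef.of_dotProduct_mulVec_nonneg
        (by rw [Matrix.IsHermitian, Matrix.conjTranspose_eq_transpose_of_trivial]; exact h.1)
        fun v => by simpa using h.2 v⟩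
  rw [this]
  refine isClosed_isSymm.inter (isClosed_iInter fun v => isClosed_le continuous_const ?_)
  exact continuous_const.dotProduct (continuous_id.matrix_mulVec continuous_const)

/-- If all weights are positive then the regularised problem has a solution. -/
theorem exists_isSolution {q : Config J → ℝ} {c₀ γ δ : ℝ} (hc₀ : 0 < c₀) (hq : ∀ x, c₀ ≤ q x)
    (hγ : 0 ≤ γ) (hδ : 0 < δ) : ∃ L S, IsSolution q γ δ L S := by
  set F : Matrix (Fin J) (Fin J) ℝ × Matrix (Fin J) (Fin J) ℝ → ℝ :=
    fun p => wObjective q γ δ p.1 p.2 with hF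
  have hFc : Continuous F := by
    refine (((continuous_wLoss q).comp (continuous_fst.add continuous_snd)).add
      (continuous_const.mul (continuous_offDiagL1.comp continuous_snd))).add
      (continuous_const.mul continuous_fst.matrix_trace)
  -- This sublevel set is compact: the trace penalty bounds `L` and the coercive loss bounds `L +
  -- S`, hence also `S`, whose diagonal is not penalized.
  set T : Set (Matrix (Fin J) (Fin J) ℝ × Matrix (Fin J) (Fin J) ℝ) :=
    {p | p.1.PosSemidef ∧ p.2.IsSymm ∧ F p ≤ F (0, 0)} with hT
  have hcl : IsClosed T :=
    (isClosed_posSemidef.preimage continuous_fst).inter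
      ((isClosed_isSymm.preimage continuous_snd).inter (isClosed_le hFc continuous_const))
  have hbd : Bornology.IsBounded T := by
    refine (Metric.isBounded_closedBall (x := (0 : Matrix (Fin J) (Fin J) ℝ × _))
      (r := F (0, 0) / δ + 2 * (F (0, 0) / c₀))).subset ?_
    rintro ⟨L, S⟩ ⟨hL, hS, hle⟩
    have h1 := wLoss_nonneg (fun x => hc₀.le.trans (hq x)) (L + S)
    have h2 := mul_nonneg hγ (offDiagL1_nonneg S)
    have h3 := mul_nonneg hδ.le hL.trace_nonneg
    change wLoss q (L + S) + γ * offDiagL1 S + δ * L.trace ≤ _ at hle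
    have hL' : ‖L‖ ≤ F (0, 0) / δ := by
      refine (norm_le_trace hL).trans ?_
      rw [le_div_iff₀ hδ]; linarith
    have hM' : ‖L + S‖ ≤ 2 * (F (0, 0) / c₀) := by
      refine (norm_le_wLoss hc₀ hq ((isSymm_of_posSemidef hL).add hS)).trans ?_
      gcongr
      linarith
    have hS' : ‖S‖ ≤ F (0, 0) / δ + 2 * (F (0, 0) / c₀) := by
      have : S = (L + S) - L := by abel
      rw [this]
      exact (norm_sub_le _ _).trans (by linarith)
    rw [mem_closedBall_zero_iff, Prod.norm_def]
    exact max_le (by linarith [norm_nonneg (L + S)]) hS'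
  have : ProperSpace (Matrix (Fin J) (Fin J) ℝ) := FiniteDimensional.proper ℝ _
  have hcomp := Metric.isCompact_of_isClosed_isBounded hcl hbd
  have h0 : ((0, 0) : Matrix (Fin J) (Fin J) ℝ × Matrix (Fin J) (Fin J) ℝ) ∈ T :=
    ⟨Matrix.PosSemidef.zero, Matrix.isSymm_zero, le_rfl⟩
  obtain ⟨p, hp, hmin⟩ := hcomp.exists_isMinOn ⟨_, h0⟩ hFc.continuousOn
  rw [isMinOn_iff] at hmin
  refine ⟨p.1, p.2, hp.1, hp.2.1, fun L' S' hL' hS' => ?_⟩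
  change F p ≤ F (L', S')
  by_cases h : F (L', S') ≤ F (0, 0)
  · exact hmin _ ⟨hL', hS', h⟩
  · exact (hmin _ h0).trans (not_le.1 h).le

/-! ### Consequences of transversality -/

/-- Addition `𝒮 × 𝒯 → 𝒮 + 𝒯` is injective, and an injective linear map in finite dimension is
bounded below. -/
theorem exists_transversality_constant {𝒮 𝒯 : Submodule ℝ (Matrix (Fin J) (Fin J) ℝ)}
    (h : 𝒮 ⊓ 𝒯 = ⊥) :
    ∃ C : ℝ, 0 < C ∧ ∀ A ∈ 𝒮, ∀ B ∈ 𝒯, ‖A‖ ≤ C * ‖A + B‖ ∧ ‖B‖ ≤ C * ‖A + B‖ := by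
  set f : 𝒮 × 𝒯 →ₗ[ℝ] Matrix (Fin J) (Fin J) ℝ := 𝒮.subtype.coprod 𝒯.subtype with hf
  have hker : LinearMap.ker f = ⊥ := by
    rw [LinearMap.ker_eq_bot']
    rintro ⟨⟨A, hA⟩, ⟨B, hB⟩⟩ hAB
    have e : A + B = 0 := by simpa [hf] using hAB
    have hA' : A ∈ 𝒮 ⊓ 𝒯 := ⟨hA, by
      rw [eq_neg_of_add_eq_zero_left e]; exact 𝒯.neg_mem hB⟩
    rw [h, Submodule.mem_bot] at hA'
    rw [hA', zero_add] at e
    simp [hA', e]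
  obtain ⟨C, hC, hanti⟩ := f.exists_antilipschitzWith hker
  refine ⟨C, hC, fun A hA B hB => ?_⟩
  have h1 := hanti.le_mul_dist (⟨A, hA⟩, ⟨B, hB⟩) 0
  rw [map_zero, dist_zero_right, dist_zero_right, Prod.norm_def] at h1
  have h2 : f (⟨A, hA⟩, ⟨B, hB⟩) = A + B := by simp [hf]
  rw [h2] at h1
  exact max_le_iff.1 h1

theorem norm_mul_le_card (A B : Matrix (Fin J) (Fin J) ℝ) : ‖A * B‖ ≤ J * (‖A‖ * ‖B‖) := by
  refine norm_le_of_entries (by positivity) fun i j => ?_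
  rw [Matrix.mul_apply]
  refine (Finset.abs_sum_le_sum_abs _ _).trans ?_
  calc _ ≤ ∑ _k : Fin J, ‖A‖ * ‖B‖ := by
        refine Finset.sum_le_sum fun k _ => ?_
        rw [abs_mul]
        exact mul_le_mul (abs_entry_le A i k) (abs_entry_le B k j) (abs_nonneg _) (norm_nonneg _)
    _ = _ := by simp

variable {S₀ W L₀ : Matrix (Fin J) (Fin J) ℝ} {U : Matrix (Fin J) (Fin K) ℝ} {ρ κ : ℝ}

theorem norm_compression_le (hU : U.transpose * U = 1) {L : Matrix (Fin J) (Fin J) ℝ}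
    (hL : L.PosSemidef) : ‖coProj U * L * coProj U‖ ≤ ip (coProj U) L := by
  rw [ip_coProj hU]
  refine norm_le_trace ?_
  have := hL.conjTranspose_mul_mul_same (coProj U)
  rwa [Matrix.conjTranspose_eq_transpose_of_trivial, transpose_coProj] at this

/-- Stability of the decomposition of a matrix into its low rank and sparse parts. -/
theorem exists_decomposition_constant (hU : U.transpose * U = 1)
    (hA3 : sparseSpace S₀ ⊓ tangentSpace U = ⊥) (hS₀ : S₀.IsSymm) (hL₀ : L₀.IsSymm)
    (hQL₀ : coProj U * L₀ = 0) :
    ∃ C : ℝ, 0 < C ∧ ∀ L S : Matrix (Fin J) (Fin J) ℝ, L.PosSemidef → S ∈ sparseSpace S₀ →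
      ∀ t : ℝ, ‖L + S - (L₀ + S₀)‖ ≤ t → ip (coProj U) L ≤ t →
        ‖L - L₀‖ ≤ C * t ∧ ‖S - S₀‖ ≤ C * t := by
  obtain ⟨C, hC, h⟩ := exists_transversality_constant hA3
  refine ⟨2 * C + 1, by positivity, fun L S hL hS t ht htL => ?_⟩
  set E := coProj U * L * coProj U with hE
  have hEt : ‖E‖ ≤ t := (norm_compression_le hU hL).trans htL
  have ht0 : 0 ≤ t := (norm_nonneg _).trans hEt
  -- The truth has no compression, so removing that of `L` makes the error tangent; transversality
  -- then separates it from `S - S₀`, and `E` accounts for the extra `1` in the constant.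
  have hT : L - L₀ - E ∈ tangentSpace U := by
    have := sub_compression_mem_tangentSpace U ((isSymm_of_posSemidef hL).sub hL₀)
    rwa [Matrix.mul_sub, hQL₀, sub_zero] at this
  have hSS : S - S₀ ∈ sparseSpace S₀ :=
    (sparseSpace S₀).sub_mem hS ⟨hS₀, fun _ _ _ h => h⟩
  obtain ⟨h1, h2⟩ := h _ hSS _ hT
  have e : S - S₀ + (L - L₀ - E) = (L + S - (L₀ + S₀)) - E := by abel
  have h3 : ‖S - S₀ + (L - L₀ - E)‖ ≤ 2 * t := by
    rw [e]; exact (norm_sub_le _ _).trans (by linarith)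
  have h4 : C * ‖S - S₀ + (L - L₀ - E)‖ ≤ C * (2 * t) := by gcongr
  constructor
  · have e2 : L - L₀ = (L - L₀ - E) + E := by abel
    rw [e2]
    exact (norm_add_le _ _).trans (by linarith)
  · linarith

/-- A sparse matrix annihilated by a dual variable close to the certificate vanishes. -/
theorem IsCertificate.exists_injectivity_radius (hW : IsCertificate S₀ U ρ κ W)
    (hU : U.transpose * U = 1) (hA3 : sparseSpace S₀ ⊓ tangentSpace U = ⊥) :
    ∃ ν : ℝ, 0 < ν ∧ ∀ (g E : Matrix (Fin J) (Fin J) ℝ) (γ : ℝ), 0 < γ →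
      ‖g + γ • W‖ ≤ ν * γ → E ∈ sparseSpace S₀ →
      (g + (ρ * γ) • (1 : Matrix (Fin J) (Fin J) ℝ)) * E = 0 → E = 0 := by
  obtain ⟨C, hC, h⟩ := exists_transversality_constant hA3
  have hκ := hW.pos
  set Q := coProj U with hQ
  set a : ℝ := (C * (J * ‖Q‖)) ^ 2 * (J : ℝ) ^ 3 with ha
  have ha0 : 0 ≤ a := by positivity
  -- This radius yields `‖E‖² ≤ (a ν / κ) ‖E‖²` with `a ν / κ ≤ 1/2`.
  refine ⟨κ / (2 * (a + 1)), by positivity, fun g E γ hγ hg hE hgE => ?_⟩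
  set ν := κ / (2 * (a + 1)) with hν
  have hν0 : 0 < ν := by positivity
  set r : ℝ := (J : ℝ) ^ 3 * ν / κ * ‖E‖ ^ 2 with hr
  have hr0 : 0 ≤ r := by positivity
  -- Each column of `E` is in the kernel of the dual variable, hence nearly in the column space of
  -- `U`: `Q E` is of order `√ν ‖E‖`.
  have hQE : ‖Q * E‖ ≤ Real.sqrt r := by
    refine norm_le_of_entries (Real.sqrt_nonneg _) fun i j => Real.abs_le_sqrt ?_
    set b : Fin J → ℝ := fun k => E k j with hb
    have hgb : (g + (ρ * γ) • (1 : Matrix (Fin J) (Fin J) ℝ)).mulVec b = 0 := by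
      ext k
      exact congrFun (congrFun hgE k) j
    have h1 := hW.dotProduct_coProj_le hγ hg hgb
    rw [dotProduct_coProj hU] at h1
    have h2 : b ⬝ᵥ b ≤ J * ‖E‖ ^ 2 := by
      calc b ⬝ᵥ b ≤ ∑ _k : Fin J, ‖E‖ ^ 2 := by
            refine Finset.sum_le_sum fun k _ => ?_
            rw [← sq, ← sq_abs]
            gcongr
            exact abs_entry_le E k j
        _ = _ := by simp
    have h3 : (Q * E) i j ^ 2 ≤ Q.mulVec b ⬝ᵥ Q.mulVec b := by
      rw [sq]
      exact Finset.single_le_sum (f := fun i => Q.mulVec b i * Q.mulVec b i)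
        (fun i _ => mul_self_nonneg _) (Finset.mem_univ i)
    refine h3.trans ?_
    rw [hr, div_mul_eq_mul_div, le_div_iff₀ hκ, mul_comm]
    refine h1.trans ?_
    calc (J : ℝ) ^ 2 * ν * (b ⬝ᵥ b) ≤ (J : ℝ) ^ 2 * ν * (J * ‖E‖ ^ 2) := by gcongr
      _ = _ := by ring
  -- `E` is sparse and within `Q E Q` of a tangent matrix, so transversality bounds `‖E‖` by a
  -- multiple of `‖Q E Q‖`.
  have hT : -(E - Q * E * Q) ∈ tangentSpace U :=
    (tangentSpace U).neg_mem (sub_compression_mem_tangentSpace U hE.1)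
  have h1 := (h E hE _ hT).1
  have e : E + -(E - Q * E * Q) = Q * E * Q := by abel
  rw [e] at h1
  have h2 : ‖E‖ ≤ C * (J * ‖Q‖) * Real.sqrt r := by
    refine h1.trans ?_
    calc C * ‖Q * E * Q‖ ≤ C * (J * (‖Q * E‖ * ‖Q‖)) := by gcongr; exact norm_mul_le_card _ _
      _ ≤ C * (J * (Real.sqrt r * ‖Q‖)) := by gcongr
      _ = _ := by ring
  have h3 : ‖E‖ ^ 2 ≤ (C * (J * ‖Q‖)) ^ 2 * r := by
    calc ‖E‖ ^ 2 ≤ (C * (J * ‖Q‖) * Real.sqrt r) ^ 2 := by gcongr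
      _ = _ := by rw [mul_pow _ (Real.sqrt r), Real.sq_sqrt hr0]
  have h4 : (C * (J * ‖Q‖)) ^ 2 * r = a / (2 * (a + 1)) * ‖E‖ ^ 2 := by
    rw [hr, hν, ha]; field_simp
  have h5 : a / (2 * (a + 1)) ≤ 1 / 2 := by
    rw [div_le_div_iff₀ (by positivity) (by positivity)]; linarith
  rw [h4] at h3
  have h6 : ‖E‖ ^ 2 ≤ 1 / 2 * ‖E‖ ^ 2 := h3.trans (by gcongr)
  have h7 : ‖E‖ ^ 2 ≤ 0 := by linarith
  exact norm_eq_zero.1 (pow_eq_zero_iff (two_ne_zero) |>.1 (le_antisymm h7 (sq_nonneg _)))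

/-! ### The low rank part of the truth -/

variable {d : Fin K → ℝ}

theorem coProj_mul_lowRank (hU : U.transpose * U = 1)
    (hL : L₀ = U * Matrix.diagonal d * U.transpose) : coProj U * L₀ = 0 := by
  rw [hL, ← Matrix.mul_assoc, ← Matrix.mul_assoc, coProj_mul hU, Matrix.zero_mul, Matrix.zero_mul]

theorem lowRank_isSymm (hL : L₀ = U * Matrix.diagonal d * U.transpose) : L₀.IsSymm := by
  rw [hL, Matrix.IsSymm, Matrix.transpose_mul, Matrix.transpose_mul, Matrix.transpose_transpose,
    Matrix.diagonal_transpose, Matrix.mul_assoc]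

theorem lowRank_mem_tangentSpace (hU : U.transpose * U = 1)
    (hL : L₀ = U * Matrix.diagonal d * U.transpose) : L₀ ∈ tangentSpace U := by
  have := sub_compression_mem_tangentSpace U (lowRank_isSymm hL)
  rwa [coProj_mul_lowRank hU hL, Matrix.zero_mul, sub_zero] at this

/-- Lower semicontinuity of the rank at `L₀`. -/
theorem exists_le_rank (hU : U.transpose * U = 1) (hd : ∀ k, 0 < d k)
    (hL : L₀ = U * Matrix.diagonal d * U.transpose) :
    ∃ ε : ℝ, 0 < ε ∧ ∀ L : Matrix (Fin J) (Fin J) ℝ, ‖L - L₀‖ < ε → K ≤ L.rank := by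
  -- The compression `Uᵀ L U` is the invertible `diagonal d` at `L₀`, and invertibility is an open
  -- condition.
  have hc : Continuous fun L : Matrix (Fin J) (Fin J) ℝ => (U.transpose * L * U).det :=
    ((continuous_const.matrix_mul continuous_id).matrix_mul continuous_const).matrix_det
  have h0 : (U.transpose * L₀ * U).det ≠ 0 := by
    have : U.transpose * L₀ * U = Matrix.diagonal d := by
      rw [hL, Matrix.mul_assoc, Matrix.mul_assoc, hU, Matrix.mul_one, ← Matrix.mul_assoc, hU,
        Matrix.one_mul]
    rw [this, Matrix.det_diagonal]
    exact Finset.prod_ne_zero_iff.2 fun k _ => (hd k).ne'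
  obtain ⟨ε, hε, hball⟩ := Metric.eventually_nhds_iff.1 (hc.continuousAt.eventually_ne h0)
  refine ⟨ε, hε, fun L hLε => ?_⟩
  have h1 := hball (by rwa [dist_eq_norm] : dist L L₀ < ε)
  have h2 : (U.transpose * L * U).rank = K := by
    simpa using Matrix.rank_of_isUnit (U.transpose * L * U)
      ((Matrix.isUnit_iff_isUnit_det _).2 (isUnit_iff_ne_zero.2 h1))
  calc K = (U.transpose * L * U).rank := h2.symm
    _ ≤ (U.transpose * L).rank := Matrix.rank_mul_le_left _ _
    _ ≤ L.rank := Matrix.rank_mul_le_right _ _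

theorem rank_lowRank (hU : U.transpose * U = 1) (hd : ∀ k, 0 < d k)
    (hL : L₀ = U * Matrix.diagonal d * U.transpose) : L₀.rank = K := by
  obtain ⟨ε, hε, h⟩ := exists_le_rank hU hd hL
  refine le_antisymm ?_ (h L₀ (by simpa using hε))
  rw [hL]
  refine (Matrix.rank_mul_le_right _ _).trans ?_
  simpa using Matrix.rank_le_card_height U.transpose

/-- A tangent direction can be corrected to second order so as to stay positive semidefinite. -/
theorem exists_posSemidef_correction (hd : ∀ k, 0 < d k)
    (hL : L₀ = U * Matrix.diagonal d * U.transpose) {B : Matrix (Fin J) (Fin J) ℝ}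
    (hB : B ∈ tangentSpace U) :
    ∃ E : Matrix (Fin J) (Fin J) ℝ, ∀ γ : ℝ, (L₀ - γ • B + γ ^ 2 • E).PosSemidef := by
  obtain ⟨Y, rfl⟩ := hB
  set D := Matrix.diagonal d with hD
  set D' : Matrix (Fin K) (Fin K) ℝ := Matrix.diagonal fun k => (d k)⁻¹ with hD'
  have h1 : D * D' = 1 := by
    rw [hD, hD', Matrix.diagonal_mul_diagonal, ← Matrix.diagonal_one]
    congr 1; ext k; exact mul_inv_cancel₀ (hd k).ne'
  have h2 : D' * D = 1 := by
    rw [hD, hD', Matrix.diagonal_mul_diagonal, ← Matrix.diagonal_one]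
    congr 1; ext k; exact inv_mul_cancel₀ (hd k).ne'
  have hDt : D'.transpose = D' := Matrix.diagonal_transpose _
  -- This completes the square: `(U - γ Yᵀ D⁻¹) D (U - γ Yᵀ D⁻¹)ᵀ`.
  refine ⟨Y.transpose * D' * Y, fun γ => ?_⟩
  have hp : D.PosSemidef := Matrix.PosSemidef.diagonal fun k => (hd k).le
  have h3 := hp.mul_mul_conjTranspose_same (U - γ • (Y.transpose * D'))
  have e : (U - γ • (Y.transpose * D')) * D * (U - γ • (Y.transpose * D')).conjTranspose =
      L₀ - γ • (U * Y + Y.transpose * U.transpose) + γ ^ 2 • (Y.transpose * D' * Y) := by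
    rw [Matrix.conjTranspose_eq_transpose_of_trivial, Matrix.transpose_sub,
      Matrix.transpose_smul, Matrix.transpose_mul, Matrix.transpose_transpose, hDt, hL]
    have e1 : U * D * (D' * Y) = U * Y := by
      rw [← Matrix.mul_assoc, Matrix.mul_assoc U, h1, Matrix.mul_one]
    have e2 : Y.transpose * D' * D = Y.transpose := by
      rw [Matrix.mul_assoc, h2, Matrix.mul_one]
    simp only [Matrix.sub_mul, Matrix.mul_sub, Matrix.smul_mul, Matrix.mul_smul, e1, e2,
      ← Matrix.mul_assoc Y.transpose D' Y]
    module
  rwa [e] at h3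

end Stability

/-! ### Deterministic recovery as the regularization vanishes -/

section Asymptotics

variable {J K : ℕ}

/-! ### Asymptotics of the weighted problem -/

/-- The regularisation parameter `γ` tends to zero and the weights `q` approach `p` faster than
`γ` does. -/
structure IsRegime {ι : Type*} (l : Filter ι) (p : Config J → ℝ) (γ : ι → ℝ)
    (q : ι → Config J → ℝ) : Prop where
  tendsto : Tendsto γ l (𝓝[>] 0)
  weights : ∀ x, (fun i => q i x - p x) =o[l] γ

variable {ι : Type*} {l : Filter ι} {p : Config J → ℝ} {γ : ι → ℝ} {q : ι → Config J → ℝ}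

theorem IsRegime.eventually_pos (h : IsRegime l p γ q) : ∀ᶠ i in l, 0 < γ i :=
  h.tendsto.eventually self_mem_nhdsWithin

theorem IsRegime.eventually_le (h : IsRegime l p γ q) {r : ℝ} (hr : 0 < r) :
    ∀ᶠ i in l, γ i ≤ r :=
  h.tendsto.eventually (mem_nhdsWithin_of_mem_nhds (Iic_mem_nhds hr))

theorem IsRegime.eventually_sum_le (h : IsRegime l p γ q) {ν : ℝ} (hν : 0 < ν) :
    ∀ᶠ i in l, ∑ x, |q i x - p x| ≤ ν * γ i := by
  have h1 : (fun i => ∑ x, |q i x - p x|) =o[l] γ :=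
    Asymptotics.IsLittleO.fun_sum fun x _ => (h.weights x).abs_left
  filter_upwards [h1.def hν, h.eventually_pos] with i hi hpos
  rwa [Real.norm_of_nonneg (Finset.sum_nonneg fun x _ => abs_nonneg _),
    Real.norm_of_nonneg hpos.le] at hi

/-- Every configuration has positive probability and there are finitely many, so half the smallest
probability serves as a uniform lower bound. -/
theorem IsRegime.exists_bounds (h : IsRegime l p γ q) (hp : ∀ x, 0 < p x) :
    ∃ c₀ : ℝ, 0 < c₀ ∧ ∀ᶠ i in l, ∀ x, c₀ ≤ q i x ∧ q i x ≤ p x + 1 := by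
  obtain ⟨x₀, hx₀⟩ := Finite.exists_min p
  refine ⟨p x₀ / 2, half_pos (hp x₀), ?_⟩
  filter_upwards [h.eventually_sum_le one_pos,
    h.eventually_le (lt_min (half_pos (hp x₀)) one_pos)] with i hi hγ x
  have h1 : |q i x - p x| ≤ ∑ x, |q i x - p x| :=
    Finset.single_le_sum (f := fun x => |q i x - p x|) (fun x _ => abs_nonneg _)
      (Finset.mem_univ x)
  have h2 := abs_le.1 (h1.trans (hi.trans ((one_mul _).trans_le hγ)))
  have h3 := min_le_left (p x₀ / 2) 1
  have h4 := min_le_right (p x₀ / 2) 1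
  have h5 := hx₀ x
  constructor <;> linarith [h2.1, h2.2]

variable {M₀ L₀ S₀ W A B : Matrix (Fin J) (Fin J) ℝ} {U : Matrix (Fin J) (Fin K) ℝ}
  {d : Fin K → ℝ} {ρ κ : ℝ}

/-- At points close to `M₀ - γ Δ` the gradient is close to `-γ I(Δ)`. -/
theorem IsRegime.exists_gradient_bound (h : IsRegime l (pmf M₀) γ q)
    (Δ : Matrix (Fin J) (Fin J) ℝ) {ν : ℝ} (hν : 0 < ν) :
    ∃ ν' : ℝ, 0 < ν' ∧ ∀ᶠ i in l, ∀ M : Matrix (Fin J) (Fin J) ℝ,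
      ‖M - M₀ + γ i • Δ‖ ≤ ν' * γ i → ‖wGrad (q i) M + γ i • infoApply M₀ Δ‖ ≤ ν * γ i := by
  obtain ⟨C, hC, hexp⟩ := exists_norm_wGrad_add_le M₀
  set ν' := ν / (3 * (C + 1)) with hν'
  have hν'0 : 0 < ν' := by positivity
  refine ⟨ν', hν'0, ?_⟩
  set D := ν' + ‖Δ‖ with hD
  have hD0 : 0 < D := by positivity
  filter_upwards [h.eventually_pos, h.eventually_sum_le hν'0,
    h.eventually_le (show 0 < ν' / D ^ 2 by positivity)] with i hpos hsum hle M hM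
  have h1 : ‖M - M₀‖ ≤ D * γ i := by
    have e : M - M₀ = (M - M₀ + γ i • Δ) - γ i • Δ := by abel
    rw [e]
    refine (norm_sub_le _ _).trans ?_
    rw [norm_smul, Real.norm_of_nonneg hpos.le, hD]
    linarith
  -- The Taylor remainder is of order `γ²`, absorbed once `γ ≤ ν' / D²`. It is one of three errors
  -- of size at most `ν' γ`, whence the `3` in `ν'`.
  have h2 : ‖M - M₀‖ ^ 2 ≤ ν' * γ i := by
    calc ‖M - M₀‖ ^ 2 ≤ (D * γ i) ^ 2 := by gcongr
      _ = D ^ 2 * γ i * γ i := by ring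
      _ ≤ ν' * γ i := by
          gcongr
          rwa [le_div_iff₀' (by positivity)] at hle
  calc _ ≤ C * ((∑ x, |q i x - pmf M₀ x|) + ‖M - M₀‖ ^ 2 + ‖M - M₀ + γ i • Δ‖) := hexp _ _ _ _
    _ ≤ (C + 1) * (ν' * γ i + ν' * γ i + ν' * γ i) := by gcongr; linarith
    _ = ν * γ i := by rw [hν']; field_simp; ring

/-- A solution does no worse than the truth, whose objective stays bounded; coercivity then bounds
`L + S`, giving a fixed ball for strong monotonicity. -/
theorem IsRegime.exists_solution_bound (h : IsRegime l (pmf M₀) γ q) (hρ : 0 < ρ)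
    (hL₀ : L₀.PosSemidef) (hS₀ : S₀.IsSymm) :
    ∃ R : ℝ, ∀ᶠ i in l, ∀ L S, IsSolution (q i) (γ i) (ρ * γ i) L S → ‖L + S‖ ≤ R := by
  obtain ⟨c₀, hc₀, hb⟩ := h.exists_bounds (pmf_pos M₀)
  refine ⟨2 * ((wLoss (fun x => pmf M₀ x + 1) (L₀ + S₀) + offDiagL1 S₀ + ρ * L₀.trace) / c₀), ?_⟩
  filter_upwards [hb, h.eventually_pos, h.eventually_le one_pos] with i hi hpos hle L S hsol
  refine (norm_le_wLoss hc₀ (fun x => (hi x).1)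
    ((isSymm_of_posSemidef hsol.posSemidef).add hsol.isSymm)).trans ?_
  gcongr
  have h1 := hsol.le L₀ S₀ hL₀ hS₀
  rw [wObjective, wObjective] at h1
  have h2 := wLoss_mono (fun x => (hi x).2) (L₀ + S₀)
  have h3 := mul_nonneg hpos.le (offDiagL1_nonneg S)
  have h4 := mul_nonneg (mul_pos hρ hpos).le hsol.posSemidef.trace_nonneg
  have h5 := mul_le_of_le_one_left (offDiagL1_nonneg S₀) hle
  have h6 : ρ * γ i * L₀.trace ≤ ρ * L₀.trace := by
    rw [mul_right_comm]
    exact mul_le_of_le_one_right (mul_nonneg hρ.le hL₀.trace_nonneg) hle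
  linarith

/-- Nonzero entries keep their sign under small perturbation, and `A` vanishes at the other
off-diagonal positions. This makes the certificate tight for the `ℓ₁` penalty at the reference
point. -/
theorem eventually_sign_sub_smul_eq {f : ι → ℝ} (hf : Tendsto f l (𝓝 0)) (hA : A ∈ sparseSpace S₀) :
    ∀ᶠ i in l, ∀ a b, a ≠ b → Real.sign ((S₀ - f i • A) a b) = Real.sign (S₀ a b) := by
  rw [eventually_all]; intro a
  rw [eventually_all]; intro b
  by_cases hab : a = b
  · exact Eventually.of_forall fun i h => absurd hab h
  have hlim : Tendsto (fun i => (S₀ - f i • A) a b) l (𝓝 (S₀ a b)) := by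
    have : Tendsto (fun i => S₀ a b - f i * A a b) l (𝓝 (S₀ a b - 0 * A a b)) :=
      tendsto_const_nhds.sub (hf.mul_const _)
    simpa using this
  rcases lt_trichotomy (S₀ a b) 0 with h | h | h
  · filter_upwards [hlim.eventually (gt_mem_nhds h)] with i hi _
    rw [Real.sign_of_neg hi, Real.sign_of_neg h]
  · refine Eventually.of_forall fun i _ => ?_
    rw [Matrix.sub_apply, Matrix.smul_apply, hA.2 a b hab h, smul_zero, sub_zero]
  · filter_upwards [hlim.eventually (lt_mem_nhds h)] with i hi _
    rw [Real.sign_of_pos hi, Real.sign_of_pos h]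

/-- Solutions agree with the truth to first order in `γ`, and their component outside the column
space of `U` is small. -/
theorem IsRegime.eventually_close (h : IsRegime l (pmf (L₀ + S₀)) γ q) (hρ : 0 < ρ)
    (hS₀ : S₀.IsSymm) (hU : U.transpose * U = 1) (hd : ∀ k, 0 < d k)
    (hL : L₀ = U * Matrix.diagonal d * U.transpose) (hA : A ∈ sparseSpace S₀)
    (hB : B ∈ tangentSpace U) (hW : IsCertificate S₀ U ρ κ (infoApply (L₀ + S₀) (A + B)))
    {ν : ℝ} (hν : 0 < ν) :
    ∀ᶠ i in l, ∀ L S, IsSolution (q i) (γ i) (ρ * γ i) L S →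
      ‖L + S - (L₀ + S₀) + γ i • (A + B)‖ ≤ ν * γ i ∧ ip (coProj U) L ≤ ν := by
  set W := infoApply (L₀ + S₀) (A + B) with hWdef
  obtain ⟨E, hE⟩ := exists_posSemidef_correction hd hL hB
  have hL₀ : L₀.PosSemidef := by simpa using hE 0
  obtain ⟨c₀, hc₀, hbounds⟩ := h.exists_bounds (pmf_pos _)
  obtain ⟨R, hR⟩ := h.exists_solution_bound hρ hL₀ hS₀
  set Δ := A + B with hΔ
  obtain ⟨c, hc, hmono⟩ := exists_wGrad_strongly_monotone
    (max R (‖L₀ + S₀‖ + ‖Δ‖ + ‖E‖)) hc₀ (J := J)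
  have hκ := hW.pos
  -- The target is `(c/2) ‖m‖² + γ κ ⟨Q, L⟩ ≤ ν₃ γ²`: the first entry then gives `‖m‖ ≤ (ν/2) γ`,
  -- the second `⟨Q, L⟩ ≤ ν γ`.
  set ν₃ := min (c * (ν / 2) ^ 2 / 2) (κ * ν) with hν₃
  have hν₃0 : 0 < ν₃ := lt_min (by positivity) (by positivity)
  -- Gradient accuracy at the reference point, tuned to the Young inequality below.
  set ν₁ := Real.sqrt (c * ν₃) / ((J : ℝ) ^ 2 + 1) with hν₁
  have hν₁0 : 0 < ν₁ := by positivity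
  have hν₁sq : ((J : ℝ) ^ 2 * ν₁) ^ 2 ≤ c * ν₃ := by
    have : (J : ℝ) ^ 2 * ν₁ ≤ Real.sqrt (c * ν₃) := by
      rw [hν₁, mul_div_assoc', div_le_iff₀ (by positivity)]
      nlinarith [Real.sqrt_nonneg (c * ν₃)]
    calc ((J : ℝ) ^ 2 * ν₁) ^ 2 ≤ Real.sqrt (c * ν₃) ^ 2 := by gcongr
      _ = c * ν₃ := Real.sq_sqrt (by positivity)
  obtain ⟨ν', hν'0, hgrad⟩ := h.exists_gradient_bound Δ hν₁0
  set t₁ := |ρ * E.trace - ip W E| with ht₁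
  have hγ0 : Tendsto γ l (𝓝 0) := h.tendsto.mono_right nhdsWithin_le_nhds
  filter_upwards [h.eventually_pos, h.eventually_le one_pos, hbounds, hR, hgrad,
    h.eventually_le (show 0 < ν' / (‖E‖ + 1) by positivity),
    h.eventually_le (show 0 < ν / 2 / (‖E‖ + 1) by positivity),
    h.eventually_le (show 0 < ν₃ / 2 / (t₁ + 1) by positivity),
    eventually_sign_sub_smul_eq hγ0 hA] with i hpos hle1 hq hRi hgi hle2 hle3 hle4 hsign L S hsol
  set g := γ i with hg
  rw [le_div_iff₀ (by positivity)] at hle2 hle3 hle4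
  -- The reference point: first order displacement by the certificate's direction, plus the `γ²`
  -- correction that restores positive semidefiniteness.
  set L₁ := L₀ - g • B + g ^ 2 • E with hL₁
  set S₁ := S₀ - g • A with hS₁
  have hL₁p : L₁.PosSemidef := hE g
  have hS₁s : S₁.IsSymm := hS₀.sub (hA.1.smul g)
  have hM₁ : L₁ + S₁ - (L₀ + S₀) + g • Δ = g ^ 2 • E := by
    rw [hL₁, hS₁, hΔ]; module
  have hE2 : ‖g ^ 2 • E‖ = g * ‖E‖ * g := by
    rw [norm_smul, Real.norm_of_nonneg (sq_nonneg g)]; ring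
  have he := hgi (L₁ + S₁) (by
    rw [hM₁, hE2]
    gcongr
    linarith)
  have hbasic := hsol.basic_inequality hW hpos.le hL₁p hS₁s (hW.ip_eq_offDiagL1 hsign)
  set m := L + S - (L₁ + S₁) with hm
  have htr : ρ * L₁.trace - ip W L₁ = g ^ 2 * (ρ * E.trace - ip W E) := by
    have h1 := hW.ip_tangent (lowRank_mem_tangentSpace hU hL)
    have h2 := hW.ip_tangent hB
    rw [hL₁, map_add, map_sub, map_smul, map_smul, h1, h2, Matrix.trace_add, Matrix.trace_sub,
      Matrix.trace_smul, Matrix.trace_smul]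
    simp only [smul_eq_mul]
    ring
  rw [htr] at hbasic
  have hM₁n : ‖L₁ + S₁‖ ≤ ‖L₀ + S₀‖ + ‖Δ‖ + ‖E‖ := by
    have e : L₁ + S₁ = L₀ + S₀ - g • Δ + g ^ 2 • E := by rw [hL₁, hS₁, hΔ]; module
    rw [e]
    refine (norm_add_le _ _).trans (add_le_add ((norm_sub_le _ _).trans (add_le_add le_rfl ?_)) ?_)
    · rw [norm_smul, Real.norm_of_nonneg hpos.le]
      exact mul_le_of_le_one_left (norm_nonneg _) hle1
    · rw [norm_smul, Real.norm_of_nonneg (sq_nonneg g)]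
      exact mul_le_of_le_one_left (norm_nonneg _) (pow_le_one₀ hpos.le hle1)
  have hcm := hmono (q i) (fun x => (hq x).1) (L + S) (L₁ + S₁)
    ((isSymm_of_posSemidef hsol.posSemidef).add hsol.isSymm)
    ((isSymm_of_posSemidef hL₁p).add hS₁s) ((hRi L S hsol).trans (le_max_left _ _))
    (hM₁n.trans (le_max_right _ _))
  rw [← hm] at hcm
  have hem : -ip (wGrad (q i) (L₁ + S₁) + g • W) m ≤ (J : ℝ) ^ 2 * ν₁ * g * ‖m‖ := by
    refine (neg_le_abs _).trans ((abs_ip_le _ _).trans ?_)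
    calc (J : ℝ) ^ 2 * (‖wGrad (q i) (L₁ + S₁) + g • W‖ * ‖m‖)
        ≤ (J : ℝ) ^ 2 * (ν₁ * g * ‖m‖) := by gcongr
      _ = _ := by ring
  have hlast : g * (g ^ 2 * (ρ * E.trace - ip W E)) ≤ ν₃ / 2 * g ^ 2 := by
    have h1 : ρ * E.trace - ip W E ≤ t₁ := le_abs_self _
    have h2 : g * t₁ ≤ ν₃ / 2 := by linarith
    calc g * (g ^ 2 * (ρ * E.trace - ip W E)) ≤ g * (g ^ 2 * t₁) := by gcongr
      _ = (g * t₁) * g ^ 2 := by ring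
      _ ≤ _ := by gcongr
  have hT0 : 0 ≤ ip (coProj U) L := ip_nonneg_of_posSemidef (coProj_posSemidef hU) hsol.posSemidef
  -- Half of the strong monotonicity term absorbs the linear error.
  have hyoung : (J : ℝ) ^ 2 * ν₁ * g * ‖m‖ ≤ c / 2 * ‖m‖ ^ 2 + ν₃ / 2 * g ^ 2 := by
    have h1 : ((J : ℝ) ^ 2 * ν₁) ^ 2 * g ^ 2 ≤ c * ν₃ * g ^ 2 := by gcongr
    have h2 := sq_nonneg (c * ‖m‖ - (J : ℝ) ^ 2 * ν₁ * g)
    have h3 : c * ((J : ℝ) ^ 2 * ν₁ * g * ‖m‖) ≤ c * (c / 2 * ‖m‖ ^ 2 + ν₃ / 2 * g ^ 2) := by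
      nlinarith
    exact le_of_mul_le_mul_left h3 hc
  have hmain : c / 2 * ‖m‖ ^ 2 + g * (κ * ip (coProj U) L) ≤ ν₃ * g ^ 2 := by linarith
  have hmn : ‖m‖ ≤ ν / 2 * g := by
    have h1 : c / 2 * ‖m‖ ^ 2 ≤ c / 2 * (ν / 2 * g) ^ 2 := by
      have h2 : ν₃ ≤ c * (ν / 2) ^ 2 / 2 := min_le_left _ _
      have h3 : 0 ≤ g * (κ * ip (coProj U) L) := by positivity
      calc c / 2 * ‖m‖ ^ 2 ≤ ν₃ * g ^ 2 := by linarith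
        _ ≤ c * (ν / 2) ^ 2 / 2 * g ^ 2 := by gcongr
        _ = _ := by ring
    exact (sq_le_sq₀ (norm_nonneg _) (by positivity)).1 (le_of_mul_le_mul_left h1 (by positivity))
  constructor
  · have e : L + S - (L₀ + S₀) + g • Δ = m + g ^ 2 • E := by
      rw [← hM₁, hm]; abel
    rw [e]
    refine (norm_add_le _ _).trans ?_
    rw [hE2]
    have h2 : g * ‖E‖ ≤ ν / 2 := by linarith
    have h3 : g * ‖E‖ * g ≤ ν / 2 * g := by gcongr
    linarith
  · have h1 : g * (κ * ip (coProj U) L) ≤ g * (κ * ν) := by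
      have h2 : ν₃ ≤ κ * ν := min_le_right _ _
      have h3 : 0 ≤ c / 2 * ‖m‖ ^ 2 := by positivity
      calc g * (κ * ip (coProj U) L) ≤ ν₃ * g ^ 2 := by linarith
        _ ≤ κ * ν * g ^ 2 := by gcongr
        _ = g * (g * (κ * ν)) := by ring
        _ ≤ g * (κ * ν) :=
          mul_le_mul_of_nonneg_left (mul_le_of_le_one_left (by positivity) hle1) hpos.le
    exact le_of_mul_le_mul_left (le_of_mul_le_mul_left h1 hpos) hκ

/-- The gradient at solutions is close to the certificate. -/
theorem IsRegime.eventually_gradient_close (h : IsRegime l (pmf (L₀ + S₀)) γ q) (hρ : 0 < ρ)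
    (hS₀ : S₀.IsSymm) (hU : U.transpose * U = 1) (hd : ∀ k, 0 < d k)
    (hL : L₀ = U * Matrix.diagonal d * U.transpose) (hA : A ∈ sparseSpace S₀)
    (hB : B ∈ tangentSpace U) (hW : IsCertificate S₀ U ρ κ (infoApply (L₀ + S₀) (A + B)))
    {ν : ℝ} (hν : 0 < ν) :
    ∀ᶠ i in l, ∀ L S, IsSolution (q i) (γ i) (ρ * γ i) L S →
      ‖wGrad (q i) (L + S) + γ i • infoApply (L₀ + S₀) (A + B)‖ ≤ ν * γ i := by
  obtain ⟨ν', hν', hgrad⟩ := h.exists_gradient_bound (A + B) hν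
  filter_upwards [hgrad, h.eventually_close hρ hS₀ hU hd hL hA hB hW hν'] with i h1 h2 L S hsol
  exact h1 _ (h2 L S hsol).1

/-- Solutions are consistent. -/
theorem IsRegime.eventually_consistent (h : IsRegime l (pmf (L₀ + S₀)) γ q) (hρ : 0 < ρ)
    (hS₀ : S₀.IsSymm) (hU : U.transpose * U = 1) (hd : ∀ k, 0 < d k)
    (hL : L₀ = U * Matrix.diagonal d * U.transpose)
    (hA3 : sparseSpace S₀ ⊓ tangentSpace U = ⊥) (hA : A ∈ sparseSpace S₀)
    (hB : B ∈ tangentSpace U) (hW : IsCertificate S₀ U ρ κ (infoApply (L₀ + S₀) (A + B)))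
    {ε : ℝ} (hε : 0 < ε) :
    ∀ᶠ i in l, ∀ L S, IsSolution (q i) (γ i) (ρ * γ i) L S →
      S ∈ sparseSpace S₀ ∧ ‖L - L₀‖ < ε ∧ ‖S - S₀‖ < ε := by
  obtain ⟨C, hC, hdec⟩ := exists_decomposition_constant hU hA3 hS₀ (lowRank_isSymm hL)
    (coProj_mul_lowRank hU hL)
  have hκ := hW.pos
  set t := ε / (2 * C) with ht
  have ht0 : 0 < t := by positivity
  have hCt : C * t < ε := by
    have : C * t = ε / 2 := by rw [ht]; field_simp
    linarith
  filter_upwards [h.eventually_pos, h.eventually_le one_pos,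
    h.eventually_close hρ hS₀ hU hd hL hA hB hW (half_pos ht0),
    h.eventually_le (show 0 < t / 2 / (‖A + B‖ + 1) by positivity),
    h.eventually_gradient_close hρ hS₀ hU hd hL hA hB hW (half_pos hκ)]
    with i hpos hle1 hclose hle hgrad L S hsol
  rw [le_div_iff₀ (by positivity)] at hle
  have hSs := hsol.mem_sparseSpace hW hpos (half_lt_self hκ) (hgrad L S hsol)
  obtain ⟨h1, h2⟩ := hclose L S hsol
  have h3 : ‖L + S - (L₀ + S₀)‖ ≤ t := by
    have e : L + S - (L₀ + S₀) = (L + S - (L₀ + S₀) + γ i • (A + B)) - γ i • (A + B) := by abel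
    rw [e]
    refine (norm_sub_le _ _).trans ?_
    rw [norm_smul, Real.norm_of_nonneg hpos.le]
    nlinarith
  obtain ⟨h4, h5⟩ := hdec L S hsol.posSemidef hSs t h3 (by linarith)
  exact ⟨hSs, h4.trans_lt hCt, h5.trans_lt hCt⟩

/-- Eventually there is at most one solution. -/
theorem IsRegime.eventually_unique (h : IsRegime l (pmf (L₀ + S₀)) γ q) (hρ : 0 < ρ)
    (hS₀ : S₀.IsSymm) (hU : U.transpose * U = 1) (hd : ∀ k, 0 < d k)
    (hL : L₀ = U * Matrix.diagonal d * U.transpose)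
    (hA3 : sparseSpace S₀ ⊓ tangentSpace U = ⊥) (hA : A ∈ sparseSpace S₀)
    (hB : B ∈ tangentSpace U) (hW : IsCertificate S₀ U ρ κ (infoApply (L₀ + S₀) (A + B))) :
    ∀ᶠ i in l, ∀ L₁ S₁ L₂ S₂, IsSolution (q i) (γ i) (ρ * γ i) L₁ S₁ →
      IsSolution (q i) (γ i) (ρ * γ i) L₂ S₂ → L₁ = L₂ ∧ S₁ = S₂ := by
  obtain ⟨ν, hν, hinj⟩ := hW.exists_injectivity_radius hU hA3
  have hL₀ : L₀.PosSemidef := by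
    obtain ⟨E, hE⟩ := exists_posSemidef_correction hd hL hB
    simpa using hE 0
  obtain ⟨c₀, hc₀, hbounds⟩ := h.exists_bounds (pmf_pos _)
  obtain ⟨R, hR⟩ := h.exists_solution_bound hρ hL₀ hS₀
  obtain ⟨c, hc, hmono⟩ := exists_wGrad_strongly_monotone R hc₀ (J := J)
  filter_upwards [h.eventually_pos, hbounds, hR,
    h.eventually_gradient_close hρ hS₀ hU hd hL hA hB hW hν,
    h.eventually_consistent hρ hS₀ hU hd hL hA3 hA hB hW one_pos]
    with i hpos hq hRi hgrad hcons L₁ S₁ L₂ S₂ h₁ h₂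
  have hv₁ := h₁.variational hpos.le h₂.posSemidef h₂.isSymm
  have hv₂ := h₂.variational hpos.le h₁.posSemidef h₁.isSymm
  have hm := hmono (q i) (fun x => (hq x).1) (L₁ + S₁) (L₂ + S₂)
    ((isSymm_of_posSemidef h₁.posSemidef).add h₁.isSymm)
    ((isSymm_of_posSemidef h₂.posSemidef).add h₂.isSymm) (hRi _ _ h₁) (hRi _ _ h₂)
  -- Adding the two variational inequalities cancels the penalties and contradicts strong
  -- monotonicity unless the sums agree.
  have hM : L₁ + S₁ = L₂ + S₂ := by
    rw [← neg_sub (L₁ + S₁), map_neg] at hv₁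
    rw [map_sub ip, LinearMap.sub_apply] at hm
    have h0 : c * ‖L₁ + S₁ - (L₂ + S₂)‖ ^ 2 ≤ c * 0 := by linarith
    have h1 := le_antisymm (le_of_mul_le_mul_left h0 hc) (sq_nonneg _)
    exact sub_eq_zero.1 (norm_eq_zero.1 (pow_eq_zero_iff two_ne_zero |>.1 h1))
  have hE : S₂ - S₁ ∈ sparseSpace S₀ :=
    (sparseSpace S₀).sub_mem (hcons _ _ h₂).1 (hcons _ _ h₁).1
  have hLS : S₂ - S₁ = L₁ - L₂ := by
    rw [sub_eq_sub_iff_add_eq_add, add_comm S₂, ← hM]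
  -- Equal sums give equal dual variables, which annihilate `L₁` and `L₂` and hence their difference
  -- `S₂ - S₁`.
  have hz := hinj _ _ _ hpos (hgrad _ _ h₁) hE (by
    rw [hLS, Matrix.mul_sub, h₁.dual_mul_eq_zero hpos.le, hM, h₂.dual_mul_eq_zero hpos.le, sub_zero])
  exact ⟨sub_eq_zero.1 (hLS ▸ hz), (sub_eq_zero.1 hz).symm⟩

theorem exists_sign_radius (S₀ : Matrix (Fin J) (Fin J) ℝ) :
    ∃ ε : ℝ, 0 < ε ∧ ∀ S : Matrix (Fin J) (Fin J) ℝ, ‖S - S₀‖ < ε →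
      ∀ i j, S₀ i j ≠ 0 → Real.sign (S i j) = Real.sign (S₀ i j) := by
  have : ∀ᶠ S in 𝓝 S₀, ∀ i j, S₀ i j ≠ 0 → Real.sign (S i j) = Real.sign (S₀ i j) := by
    rw [eventually_all]; intro i
    rw [eventually_all]; intro j
    have hc : Continuous fun S : Matrix (Fin J) (Fin J) ℝ => S i j :=
      continuous_id.matrix_elem i j
    rcases lt_trichotomy (S₀ i j) 0 with h | h | h
    · filter_upwards [hc.continuousAt.eventually (gt_mem_nhds h)] with S hS _
      rw [Real.sign_of_neg hS, Real.sign_of_neg h]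
    · exact Eventually.of_forall fun S h' => absurd h h'
    · filter_upwards [hc.continuousAt.eventually (lt_mem_nhds h)] with S hS _
      rw [Real.sign_of_pos hS, Real.sign_of_pos h]
  obtain ⟨ε, hε, hb⟩ := Metric.eventually_nhds_iff.1 this
  exact ⟨ε, hε, fun S hS => hb (by rwa [dist_eq_norm])⟩

/-- Existence, uniqueness, consistency, sign and rank recovery for weights that approach the
true probabilities faster than the regularisation parameter vanishes. -/
theorem IsRegime.eventually_recovery (h : IsRegime l (pmf (L₀ + S₀)) γ q) (hρ : 0 < ρ)
    (hS₀ : S₀.IsSymm) (hU : U.transpose * U = 1) (hd : ∀ k, 0 < d k)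
    (hL : L₀ = U * Matrix.diagonal d * U.transpose)
    (hA3 : sparseSpace S₀ ⊓ tangentSpace U = ⊥)
    (hA4 : Irrepresentable (L₀ + S₀) S₀ U ρ) {ε : ℝ} (hε : 0 < ε) :
    ∀ᶠ i in l, ∃ L S, IsSolution (q i) (γ i) (ρ * γ i) L S ∧
      (∀ L' S', IsSolution (q i) (γ i) (ρ * γ i) L' S' → L' = L ∧ S' = S) ∧
      ‖L - L₀‖ < ε ∧ ‖S - S₀‖ < ε ∧
      (∀ i j, (i ≠ j ∨ S₀ i j ≠ 0) → Real.sign (S i j) = Real.sign (S₀ i j)) ∧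
      L.rank = L₀.rank := by
  obtain ⟨A, hA, B, hB, κ, hW⟩ := exists_certificate hS₀ hU hρ hA4
  obtain ⟨ε₁, hε₁, hrank⟩ := exists_le_rank hU hd hL
  obtain ⟨ε₂, hε₂, hsign⟩ := exists_sign_radius S₀
  obtain ⟨c₀, hc₀, hbounds⟩ := h.exists_bounds (pmf_pos _)
  have hκ := hW.pos
  have hν : 0 < κ / ((J : ℝ) ^ 2 + 1) := by positivity
  filter_upwards [h.eventually_pos, hbounds,
    h.eventually_gradient_close hρ hS₀ hU hd hL hA hB hW hν,
    h.eventually_consistent hρ hS₀ hU hd hL hA3 hA hB hW (lt_min hε (lt_min hε₁ hε₂)),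
    h.eventually_unique hρ hS₀ hU hd hL hA3 hA hB hW] with i hpos hq hgrad hcons huniq
  obtain ⟨L, S, hsol⟩ := exists_isSolution hc₀ (fun x => (hq x).1) hpos.le (mul_pos hρ hpos)
  obtain ⟨hSs, hLε, hSε⟩ := hcons L S hsol
  have hm := min_le_left ε (min ε₁ ε₂)
  have hm₁ := (min_le_right ε (min ε₁ ε₂)).trans (min_le_left _ _)
  have hm₂ := (min_le_right ε (min ε₁ ε₂)).trans (min_le_right _ _)
  refine ⟨L, S, hsol, fun L' S' h' => huniq _ _ _ _ h' hsol, hLε.trans_le hm, hSε.trans_le hm,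
    fun a b hab => ?_, ?_⟩
  · by_cases h0 : S₀ a b = 0
    · rw [hSs.2 a b (hab.resolve_right fun h => h h0) h0, h0]
    · exact hsign S (hSε.trans_le hm₂) a b h0
  · rw [rank_lowRank hU hd hL]
    refine le_antisymm (hsol.rank_le hW hpos ?_ (hgrad L S hsol)) (hrank L (hLε.trans_le hm₁))
    rw [mul_div_assoc', div_lt_iff₀ (by positivity)]
    linarith

end Asymptotics

/-! ### Empirical frequencies and the passage to probability -/

section Concentration

variable {J : ℕ}

/-! ### Concentration of the empirical frequencies -/

/-- Chebyshev's inequality for a mean of independent indicators, each of variance at most `1`. -/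
theorem measure_empFreq_deviation_le {Ω : Type*} [MeasurableSpace Ω] (P : Measure Ω)
    [IsProbabilityMeasure P] {p : Config J → ℝ} (hp : ∀ x, 0 ≤ p x) {X : ℕ → Ω → Config J}
    (hX : ∀ n, Measurable (X n)) (hind : iIndepFun X P)
    (hlaw : ∀ n x, P {ω | X n ω = x} = ENNReal.ofReal (p x)) (x : Config J) {N : ℕ} (hN : 0 < N)
    {t : ℝ} (ht : 0 < t) :
    P {ω | t ≤ |empFreq (fun i : Fin N => X i ω) x - p x|} ≤
      ENNReal.ofReal (1 / (N * t ^ 2)) := by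
  have hN' : (0 : ℝ) < N := Nat.cast_pos.2 hN
  set ind : Config J → ℝ := fun y => if y = x then 1 else 0 with hind_def
  have hindm : Measurable ind := measurable_of_finite ind
  set Z : ℕ → Ω → ℝ := fun n => ind ∘ X n with hZ
  have hZm : ∀ n, Measurable (Z n) := fun n => hindm.comp (hX n)
  have hZb : ∀ n ω, Z n ω ∈ Set.Icc (0 : ℝ) 1 := fun n ω => by
    simp only [hZ, hind_def, Function.comp_apply]
    split_ifs <;> simp
  have hZL : ∀ n, MemLp (Z n) 2 P := fun n =>
    MemLp.of_bound (hZm n).aestronglyMeasurable 1 (Eventually.of_forall fun ω => by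
      rw [Real.norm_of_nonneg (hZb n ω).1]; exact (hZb n ω).2)
  have hZE : ∀ n, P[Z n] = p x := by
    intro n
    have e : Z n = Set.indicator {ω | X n ω = x} 1 := by
      ext ω
      simp [hZ, hind_def, Set.indicator_apply]
    have hms : MeasurableSet {ω | X n ω = x} := hX n (measurableSet_singleton x)
    rw [e, integral_indicator_one hms, measureReal_def, hlaw, ENNReal.toReal_ofReal (hp x)]
  have hvar : ∀ n, variance (Z n) P ≤ 1 := fun n =>
    (variance_le_sq_of_bounded (Eventually.of_forall (hZb n)) (hZm n).aemeasurable).trans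
      (by norm_num)
  have hZind : iIndepFun Z P := hind.comp (fun _ => ind) fun _ => hindm
  set Y : Ω → ℝ := ∑ n ∈ Finset.range N, Z n with hY
  have hYL : MemLp Y 2 P := memLp_finsetSum' _ fun n _ => hZL n
  have hYvar : variance Y P ≤ N := by
    rw [hY, IndepFun.variance_sum (fun n _ => hZL n) fun i _ j _ hij => hZind.indepFun hij]
    calc _ ≤ ∑ _n ∈ Finset.range N, (1 : ℝ) := Finset.sum_le_sum fun n _ => hvar n
      _ = N := by simp
  have hYE : P[Y] = N * p x := by
    have : Y = fun ω => ∑ n ∈ Finset.range N, Z n ω := by ext ω; simp [hY]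
    rw [this, integral_finsetSum _ fun n _ => (hZL n).integrable one_le_two]
    simp [hZE]
  have hfreq : ∀ ω, empFreq (fun i : Fin N => X i ω) x = 1 / N * Y ω := by
    intro ω
    rw [empFreq, hY, Finset.sum_apply, Finset.sum_range]
    rfl
  have hset : {ω | t ≤ |empFreq (fun i : Fin N => X i ω) x - p x|} =
      {ω | N * t ≤ |Y ω - P[Y]|} := by
    ext ω
    have e : Y ω - P[Y] = N * (empFreq (fun i : Fin N => X i ω) x - p x) := by
      rw [hfreq, hYE]; field_simp
    rw [Set.mem_ofPred_eq, Set.mem_ofPred_eq, e, abs_mul, abs_of_pos hN',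
      mul_le_mul_iff_right₀ hN']
  rw [hset]
  refine (meas_ge_le_variance_div_sq hYL (by positivity)).trans (ENNReal.ofReal_le_ofReal ?_)
  calc variance Y P / (N * t) ^ 2 ≤ N / (N * t) ^ 2 := by gcongr
    _ = 1 / (N * t ^ 2) := by field_simp

/-- The probability that some empirical frequency deviates by `N ^ (-1/2 + s)` or more tends
to zero. -/
theorem tendsto_measure_deviation {Ω : Type*} [MeasurableSpace Ω] (P : Measure Ω)
    [IsProbabilityMeasure P] {p : Config J → ℝ} (hp : ∀ x, 0 ≤ p x) {X : ℕ → Ω → Config J}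
    (hX : ∀ n, Measurable (X n)) (hind : iIndepFun X P)
    (hlaw : ∀ n x, P {ω | X n ω = x} = ENNReal.ofReal (p x)) {s : ℝ} (hs : 0 < s) :
    Tendsto (fun N : ℕ => P {ω | ∃ x, (N : ℝ) ^ (-(1 / 2) + s) ≤
      |empFreq (fun i : Fin N => X i ω) x - p x|}) atTop (𝓝 0) := by
  -- A union bound over the finitely many configurations; at deviation `t = N^(-1/2+s)` each
  -- Chebyshev bound `1 / (N t²)` equals `N^(-2s)`.
  have hlim : Tendsto (fun N : ℕ => ∑ _x : Config J, ENNReal.ofReal ((N : ℝ) ^ (-(2 * s)))) atTop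
      (𝓝 0) := by
    have h1 : Tendsto (fun N : ℕ => ENNReal.ofReal ((N : ℝ) ^ (-(2 * s)))) atTop (𝓝 0) := by
      rw [← ENNReal.ofReal_zero]
      exact ENNReal.tendsto_ofReal
        ((tendsto_rpow_neg_atTop (by positivity)).comp tendsto_natCast_atTop_atTop)
    simpa using tendsto_finsetSum (Finset.univ : Finset (Config J)) fun _ _ => h1
  refine tendsto_of_tendsto_of_tendsto_of_le_of_le' tendsto_const_nhds hlim
    (Eventually.of_forall fun _ => zero_le) ?_
  filter_upwards [eventually_gt_atTop 0] with N hN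
  have hN' : (0 : ℝ) < N := Nat.cast_pos.2 hN
  rw [Set.ofPred_exists]
  refine (measure_iUnion_fintype_le P _).trans (Finset.sum_le_sum fun x _ => ?_)
  refine (measure_empFreq_deviation_le P hp hX hind hlaw x hN (by positivity)).trans
    (le_of_eq (congrArg _ ?_))
  rw [← Real.rpow_natCast ((N : ℝ) ^ _) 2, ← Real.rpow_mul hN'.le]
  nth_rewrite 1 [← Real.rpow_one (N : ℝ)]
  rw [← Real.rpow_add hN', one_div, ← Real.rpow_neg hN'.le]
  congr 1
  push_cast
  ring

/-- Pairs of a sample size and a vector of frequencies within `N ^ (-1/2 + s)` of `p`. -/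
def sampleFilter (p : Config J → ℝ) (s : ℝ) : Filter (ℕ × (Config J → ℝ)) :=
  comap Prod.fst atTop ⊓ 𝓟 {z | ∀ x, |z.2 x - p x| ≤ (z.1 : ℝ) ^ (-(1 / 2) + s)}

/-- The allowed deviation is `ρ N^(-η/2)` times `γ N`, hence `o(γ)`; `η < 1/2` makes `γ` tend to
zero. -/
theorem isRegime_sampleFilter (p : Config J → ℝ) {ρ η : ℝ} (hρ : 0 < ρ) (hη : 0 < η)
    (hη' : η < 1 / 2) {γ : ℕ → ℝ} (hγ : ∀ N : ℕ, ρ * γ N = (N : ℝ) ^ (-(1 / 2) + η)) :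
    IsRegime (sampleFilter p (η / 2)) p (fun z => γ z.1) fun z => z.2 := by
  have hγ' : ∀ N : ℕ, γ N = (N : ℝ) ^ (-(1 / 2) + η) / ρ := fun N => by
    rw [← hγ]; field_simp
  have hfst : Tendsto (Prod.fst : ℕ × (Config J → ℝ) → ℕ) (sampleFilter p (η / 2)) atTop :=
    tendsto_comap.mono_left inf_le_left
  refine ⟨?_, fun x => ?_⟩
  · refine Tendsto.comp (g := γ) ?_ hfst
    rw [tendsto_nhdsWithin_iff]
    constructor
    · have h1 := (tendsto_rpow_neg_atTop (show 0 < 1 / 2 - η by linarith)).comp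
        tendsto_natCast_atTop_atTop
      have h2 := h1.div_const ρ
      rw [zero_div] at h2
      refine h2.congr fun N => ?_
      rw [hγ', Function.comp_apply, neg_sub, sub_eq_neg_add]
    · filter_upwards [eventually_gt_atTop 0] with N hN
      have hN' : (0 : ℝ) < N := Nat.cast_pos.2 hN
      rw [Set.mem_Ioi, hγ']
      positivity
  · rw [Asymptotics.isLittleO_iff]
    intro c hc
    have h1 := (tendsto_rpow_neg_atTop (half_pos hη)).comp tendsto_natCast_atTop_atTop
    have h2 : ∀ᶠ N : ℕ in atTop, (N : ℝ) ^ (-(η / 2)) ≤ c / ρ :=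
      h1.eventually (Iic_mem_nhds (by positivity))
    have h3 : ∀ᶠ z in sampleFilter p (η / 2),
        ∀ x, |z.2 x - p x| ≤ (z.1 : ℝ) ^ (-(1 / 2) + η / 2) :=
      Filter.mem_inf_of_right (mem_principal_self _)
    filter_upwards [h3, hfst.eventually h2, hfst.eventually (eventually_gt_atTop 0)]
      with z hz1 hz2 hz3
    have hN' : (0 : ℝ) < z.1 := Nat.cast_pos.2 hz3
    rw [Real.norm_eq_abs, hγ', Real.norm_of_nonneg (by positivity)]
    refine (hz1 x).trans ?_
    have e : (z.1 : ℝ) ^ (-(1 / 2) + η / 2) =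
        (z.1 : ℝ) ^ (-(η / 2)) * (z.1 : ℝ) ^ (-(1 / 2) + η) := by
      rw [← Real.rpow_add hN']; congr 1; ring
    rw [e]
    calc _ ≤ c / ρ * (z.1 : ℝ) ^ (-(1 / 2) + η) := by gcongr
      _ = _ := by ring

/-- A property that holds eventually along `sampleFilter` holds with probability tending to one
for the empirical frequencies. -/
theorem tendsto_measure_of_eventually {Ω : Type*} [MeasurableSpace Ω] (P : Measure Ω)
    [IsProbabilityMeasure P] {p : Config J → ℝ} (hp : ∀ x, 0 ≤ p x) {X : ℕ → Ω → Config J}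
    (hX : ∀ n, Measurable (X n)) (hind : iIndepFun X P)
    (hlaw : ∀ n x, P {ω | X n ω = x} = ENNReal.ofReal (p x)) {s : ℝ} (hs : 0 < s)
    {Q : ℕ × (Config J → ℝ) → Prop} (hQ : ∀ᶠ z in sampleFilter p s, Q z)
    {G : ℕ → Ω → Prop} (hG : ∀ N ω, Q (N, empFreq fun i : Fin N => X i ω) → G N ω) :
    Tendsto (fun N : ℕ => P {ω | G N ω}) atTop (𝓝 1) := by
  have hdev := tendsto_measure_deviation P hp hX hind hlaw hs
  have hlow : Tendsto (fun N : ℕ => 1 - P {ω | ∃ x, (N : ℝ) ^ (-(1 / 2) + s) ≤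
      |empFreq (fun i : Fin N => X i ω) x - p x|}) atTop (𝓝 1) := by
    simpa using ENNReal.Tendsto.sub tendsto_const_nhds hdev (Or.inl ENNReal.one_ne_top)
  refine tendsto_of_tendsto_of_tendsto_of_le_of_le' hlow tendsto_const_nhds ?_
    (Eventually.of_forall fun N => prob_le_one)
  -- Eventually along this filter means for all large `N`, uniformly over every frequency vector
  -- within the tolerance. Thus the sample space is covered by the good event and the deviation
  -- event.
  rw [sampleFilter, eventually_inf_principal, eventually_comap] at hQ
  filter_upwards [hQ] with N hN
  rw [tsub_le_iff_right, ← measure_univ (μ := P)]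
  refine (measure_mono fun ω _ => ?_).trans (measure_union_le _ _)
  by_cases h : ∃ x, (N : ℝ) ^ (-(1 / 2) + s) ≤ |empFreq (fun i : Fin N => X i ω) x - p x|
  · exact Or.inr h
  · push Not at h
    exact Or.inl (hG N ω (hN (N, empFreq fun i : Fin N => X i ω) rfl fun x => (h x).le))

theorem solutions_eq_singleton {N : ℕ} {γ δ : ℝ} {x : Fin N → Config J}
    {L S : Matrix (Fin J) (Fin J) ℝ} (h : IsSolution (empFreq x) γ δ L S)
    (huniq : ∀ L' S', IsSolution (empFreq x) γ δ L' S' → L' = L ∧ S' = S) :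
    solutions γ δ x = {(L, S)} := by
  ext ⟨L', S'⟩
  rw [mem_solutions_iff, Set.mem_singleton_iff, Prod.mk.injEq]
  exact ⟨huniq L' S', by rintro ⟨rfl, rfl⟩; exact h⟩

end Concentration

end FLaG

end

/-! ### The main theorem -/

open FLaG
theorem theorem1 {J K : ℕ}
    (Lstar Sstar : Matrix (Fin J) (Fin J) ℝ) (hS : Sstar.IsSymm)
    -- eigendecomposition of the true `L`: it is positive semidefinite of rank `K`
    (U : Matrix (Fin J) (Fin K) ℝ) (d : Fin K → ℝ)
    (hU : U.transpose * U = 1) (hd : ∀ k, 0 < d k)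
    (hL : Lstar = U * Matrix.diagonal d * U.transpose)
    -- local identifiability
    (hA1 : LocallyIdentifiable (Lstar + Sstar))
    -- the positive eigenvalues of the true `L` are distinct
    (hA2 : Function.Injective d)
    -- transversality
    (hA3 : sparseSpace Sstar ⊓ tangentSpace U = ⊥)
    -- irrepresentable condition
    (ρ : ℝ) (hρ : 0 < ρ) (hA4 : Irrepresentable (Lstar + Sstar) Sstar U ρ) :
    ∃ η₀ : ℝ, 0 < η₀ ∧ ∀ η : ℝ, 0 < η → η < η₀ →
      ∀ (γ δ : ℕ → ℝ), (∀ N, δ N = ρ * γ N) → (∀ N, δ N = (N : ℝ) ^ (-(1 / 2) + η)) →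
      ∀ {Ω : Type*} [MeasurableSpace Ω] (P : Measure Ω) [IsProbabilityMeasure P]
        (X : ℕ → Ω → Config J), (∀ n, Measurable (X n)) → iIndepFun X P →
        (∀ n x, P {ω | X n ω = x} = ENNReal.ofReal (pmf (Lstar + Sstar) x)) →
        -- the optimization problem has a unique solution
        Tendsto (fun N : ℕ => P {ω | ∃ Lhat Shat,
            solutions (γ N) (δ N) (fun i : Fin N => X i ω) = {(Lhat, Shat)}}) atTop (𝓝 1) ∧
        -- which converges in probability to the true parameter
        (∀ ε : ℝ, 0 < ε → Tendsto (fun N : ℕ => P {ω | ∃ Lhat Shat,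
            solutions (γ N) (δ N) (fun i : Fin N => X i ω) = {(Lhat, Shat)} ∧
            maxNorm (Lhat - Lstar) < ε ∧ maxNorm (Shat - Sstar) < ε}) atTop (𝓝 1)) ∧
        -- and recovers the signs and the rank
        Tendsto (fun N : ℕ => P {ω | ∃ Lhat Shat,
            solutions (γ N) (δ N) (fun i : Fin N => X i ω) = {(Lhat, Shat)} ∧
            (∀ i j, (i ≠ j ∨ Sstar i j ≠ 0) → Real.sign (Shat i j) = Real.sign (Sstar i j)) ∧
            Lhat.rank = Lstar.rank}) atTop (𝓝 1) := by
  -- Any `η < 1/2` works: the only constraint is that `N^(-1/2+η)` tends to zero.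
  refine ⟨1 / 2, by norm_num, fun η hη hη' γ δ hδγ hδ Ω _ P _ X hX hind hlaw => ?_⟩
  have hreg := isRegime_sampleFilter (pmf (Lstar + Sstar)) hρ hη hη'
    (γ := γ) (fun N => (hδγ N).symm.trans (hδ N))
  have hrec : ∀ ε : ℝ, 0 < ε → _ := fun ε hε =>
    hreg.eventually_recovery hρ hS hU hd hL hA3 hA4 hε
  have hprob := fun ε (hε : 0 < ε) => @tendsto_measure_of_eventually J Ω _ P _ _
    (fun x => (pmf_pos (Lstar + Sstar) x).le) X hX hind hlaw _ (half_pos hη) _ (hrec ε hε)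
  refine ⟨hprob 1 one_pos ?_, fun ε hε => hprob ε hε ?_, hprob 1 one_pos ?_⟩
  · rintro N ω ⟨L, S, hsol, huniq, -⟩
    rw [← hδγ] at hsol
    simp only [← hδγ] at huniq
    exact ⟨L, S, solutions_eq_singleton hsol huniq⟩
  · rintro N ω ⟨L, S, hsol, huniq, h1, h2, -⟩
    rw [← hδγ] at hsol
    simp only [← hδγ] at huniq
    exact ⟨L, S, solutions_eq_singleton hsol huniq, (maxNorm_le_norm _).trans_lt h1,
      (maxNorm_le_norm _).trans_lt h2⟩
  · rintro N ω ⟨L, S, hsol, huniq, -, -, h3, h4⟩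
    rw [← hδγ] at hsol
    simp only [← hδγ] at huniq
    exact ⟨L, S, solutions_eq_singleton hsol huniq, h3, h4⟩
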